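/- Consider the renewal risk model with $2$-order phase-type interclaim times and exponential claim sizes. Let $c,\delta,\beta>0$ (premium rate, discount rate, claim size parameter), let $\pi_1,\pi_2\ge 0$ with $\pi_1+\pi_2=1$, and let $$\Lambda=\begin{pmatrix}-\lambda_1&\lambda_{12}&\lambda_{13}\\ \lambda_{21}&-\lambda_2&\lambda_{23}\\ 0&0&0\end{pmatrix}$$ be an intensity matrix (nonnegative off-diagonal entries, rows summing to $0$) with $\lambda_1,\lambda_2>0$, for which the phases $1,2$ are transient, i.e. the claim state $3$ is reachable from each of them. The phase process $J$ moves on $\{1,2\}$ as a Markov jump process with intensities $\Lambda$; whenever it enters state $3$ a claim occurs and $J$ restarts at once in phase $i$ with probability $\pi_i$. The claim sizes $Y_1,Y_2,\dots$ are i.i.d. exponential with rate $\beta$ and independent of $J$. With $N_t$ the number of claims up to time $t$ and $D_t$ the cumulative dividends, the surplus is $X_t=x+ct-\sum_{k=1}^{N_t}Y_k-D_t$, and ruin occurs at $\tau=\inf\{t: X_t<0\}$. For $b=(b_1,b_2)\in[0,\infty)^2$ the phase-wise barrier strategy with barriers $b$ pays, while $J$ is in phase $i$, all surplus above $b_i$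 immediately as dividend, and all incoming premium as dividend while the surplus equals $b_i$; it pays nothing while the surplus is below $b_i$. Let $$f_i^{b}(x)=\mathbb E\Big[\int_{0-}^{\tau-}e^{-\delta t}\,\mathrm dD_t\,\Big|\,J_0=i,\ X_{0-}=x\Big],\qquad x\ge 0,\ i=1,2,$$ be its expected discounted dividends until ruin. Barriers $b^*=(b_1^*,b_2^*)\in[0,\infty)^2$ are called optimal phase-wise barriers if $f_i^{b}(x)\le f_i^{b^*}(x)$ for all $b\in[0,\infty)^2$, all $i\in\{1,2\}$ and all $0\le x<b_i^*$. Theorem. Let $(b_1^*,b_2^*)$ be optimal phase-wise barriers. If $0<b_1^*<b_2^*$, then $\lambda_{23}>\lambda_{13}$. -/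

import Mathlib

open MeasureTheory ProbabilityTheory
open scoped ENNReal

noncomputable section

/-- Parameters of the renewal risk model with `n`-order phase-type interclaim times and exponential
claim sizes. The states `Fin.castSucc i`, `i : Fin n`, are the phases `1, …, n`, and `Fin.last n` is
the claim state `n + 1`; the interclaim times are the absorption times in the claim state of the
Markov jump process with intensity matrix `Λ` and initial law `π` on the phases. -/
structure RiskModel (n : ℕ) where
  /-- premium rate -/
  c : ℝ
  /-- discount rate -/
  δ : ℝ
  /-- the claim sizes are exponential with rate `β` -/
  β : ℝ
  /-- intensity matrix -/
  Λ : Matrix (Fin (n + 1)) (Fin (n + 1)) ℝ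
  /-- law of the phase in which the chain restarts after a claim -/
  π : Fin n → ℝ
  c_pos : 0 < c
  δ_pos : 0 < δ
  β_pos : 0 < β
  Λ_nonneg : ∀ i j, i ≠ j → 0 ≤ Λ i j
  Λ_row : ∀ i, ∑ j, Λ i j = 0
  Λ_last : ∀ j, Λ (Fin.last n) j = 0
  Λ_diag : ∀ i : Fin n, Λ i.castSucc i.castSucc < 0
  /-- Every phase is transient: the claim state can be reached from it. -/
  transient : ∀ i : Fin n, Relation.ReflTransGen (fun j k => 0 < Λ j k) i.castSucc (Fin.last n)
  π_nonneg : ∀ i, 0 ≤ π i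
  π_sum : ∑ i, π i = 1

namespace RiskModel

variable {n : ℕ}

/-- The randomness used in one sojourn of the phase process: the holding time in each phase, the
state entered from each phase, the phase in which the chain restarts if there is a claim, and the
claim size. -/
abbrev Noise (n : ℕ) : Type := (Fin n → ℝ) × (Fin n → Fin (n + 1)) × Fin n × ℝ

/-- `λ_i = -λ_{ii}`, the rate at which phase `i` is left. -/
def rate (M : RiskModel n) (i : Fin n) : ℝ := -M.Λ i.castSucc i.castSucc

/-- When phase `i` is left, state `j ≠ i` is entered with probability `λ_{ij} / λ_i`. -/
def jumpLaw (M : RiskModel n) (i : Fin n) : Measure (Fin (n + 1)) :=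
  ∑ j ∈ Finset.univ.erase i.castSucc,
    ENNReal.ofReal (M.Λ i.castSucc j / M.rate i) • Measure.dirac j

def restartLaw (M : RiskModel n) : Measure (Fin n) :=
  ∑ i, ENNReal.ofReal (M.π i) • Measure.dirac i

/-- The holding time in phase `i` is exponential with rate `λ_i`, the claim size is exponential
with rate `β`, and all the components are independent. -/
def stepLaw (M : RiskModel n) : Measure (Noise n) :=
  (Measure.pi fun i => expMeasure (M.rate i)).prod
    ((Measure.pi fun i => M.jumpLaw i).prod (M.restartLaw.prod (expMeasure M.β)))

lemma rate_pos (M : RiskModel n) (i : Fin n) : 0 < M.rate i :=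
  neg_pos.mpr (M.Λ_diag i)

instance (M : RiskModel n) (i : Fin n) : IsProbabilityMeasure (M.jumpLaw i) := by
  constructor
  have h0 : ∀ j ∈ Finset.univ.erase i.castSucc, 0 ≤ M.Λ i.castSucc j / M.rate i := fun j hj =>
    div_nonneg (M.Λ_nonneg _ _ (Finset.ne_of_mem_erase hj).symm) (M.rate_pos i).le
  have h1 : ∑ j ∈ Finset.univ.erase i.castSucc, M.Λ i.castSucc j = M.rate i := by
    have := Finset.add_sum_erase Finset.univ (fun j => M.Λ i.castSucc j)
      (Finset.mem_univ i.castSucc)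
    have h2 := M.Λ_row i.castSucc
    simp only [rate]
    linarith
  simp only [jumpLaw, Measure.coe_finsetSum, Finset.sum_apply, Measure.smul_apply, measure_univ,
    smul_eq_mul, mul_one]
  rw [← ENNReal.ofReal_sum_of_nonneg h0, ← Finset.sum_div, h1, div_self (M.rate_pos i).ne',
    ENNReal.ofReal_one]

instance (M : RiskModel n) : IsProbabilityMeasure M.restartLaw := by
  constructor
  simp only [restartLaw, Measure.coe_finsetSum, Finset.sum_apply, Measure.smul_apply,
    measure_univ, smul_eq_mul, mul_one]
  rw [← ENNReal.ofReal_sum_of_nonneg fun i _ => M.π_nonneg i, M.π_sum, ENNReal.ofReal_one]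

instance (M : RiskModel n) : IsProbabilityMeasure M.stepLaw := by
  have := fun i => isProbabilityMeasure_expMeasure (M.rate_pos i)
  have := isProbabilityMeasure_expMeasure M.β_pos
  unfold stepLaw
  infer_instance

/-- The underlying probability measure: independent copies of the noise for the successive
sojourns. -/
def law (M : RiskModel n) : Measure (ℕ → Noise n) :=
  Measure.infinitePi fun _ => M.stepLaw

instance (M : RiskModel n) : IsProbabilityMeasure M.law := by
  unfold law
  infer_instance

/-- The phase during the `k`-th sojourn, when the initial phase is `i`. A visit to the claim state
is followed at once by a restart. -/
def phase (i : Fin n) (ω : ℕ → Noise n) : ℕ → Fin n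
  | 0 => i
  | k + 1 => Fin.lastCases (motive := fun _ => Fin n) (ω k).2.2.1 (fun j => j)
      ((ω k).2.1 (phase i ω k))

/-- The length of the `k`-th sojourn. -/
def holding (i : Fin n) (ω : ℕ → Noise n) (k : ℕ) : ℝ := (ω k).1 (phase i ω k)

/-- The time at which the `k`-th sojourn begins. -/
def jumpTime (i : Fin n) (ω : ℕ → Noise n) (k : ℕ) : ℝ :=
  ∑ m ∈ Finset.range k, holding i ω m

/-- The claim paid at the end of the `k`-th sojourn, `0` if it does not end in the claim state. -/
def claim (i : Fin n) (ω : ℕ → Noise n) (k : ℕ) : ℝ :=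
  if (ω k).2.1 (phase i ω k) = Fin.last n then (ω k).2.2.2 else 0

/-- The surplus at the beginning of the `k`-th sojourn, before any dividend is paid there, when the
initial surplus is `x` and the phase-wise barrier strategy with barriers `b` is used: during a
sojourn in phase `j` everything above `b j` is paid out. -/
def startSurplus (M : RiskModel n) (b : Fin n → ℝ) (i : Fin n) (x : ℝ) (ω : ℕ → Noise n) : ℕ → ℝ
  | 0 => x
  | k + 1 => min (startSurplus M b i x ω k + M.c * holding i ω k) (b (phase i ω k)) - claim i ω k

/-- The surplus at time `u` after the beginning of the `k`-th sojourn, once the dividends paid up to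
and including this time are subtracted. -/
def surplus (M : RiskModel n) (b : Fin n → ℝ) (i : Fin n) (x : ℝ) (ω : ℕ → Noise n) (k : ℕ)
    (u : ℝ) : ℝ :=
  min (M.startSurplus b i x ω k + M.c * u) (b (phase i ω k))

/-- The time of ruin: the infimum of the times at which the surplus is negative. -/
def ruinTime (M : RiskModel n) (b : Fin n → ℝ) (i : Fin n) (x : ℝ) (ω : ℕ → Noise n) : EReal :=
  sInf {t : EReal | ∃ (k : ℕ) (u : ℝ), 0 ≤ u ∧ u < holding i ω k ∧
    M.surplus b i x ω k u < 0 ∧ t = ((jumpTime i ω k + u : ℝ) : EReal)}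

/-- The random measure `dD` of the dividends paid by the barrier strategy. At the beginning of each
sojourn the excess over the barrier is paid as a lump sum; then the premium is paid out at rate `c`
as long as the sojourn lasts and the surplus is at the barrier. -/
def dividends (M : RiskModel n) (b : Fin n → ℝ) (i : Fin n) (x : ℝ) (ω : ℕ → Noise n) :
    Measure ℝ :=
  Measure.sum fun k =>
    ENNReal.ofReal (M.startSurplus b i x ω k - b (phase i ω k)) •
        Measure.dirac (jumpTime i ω k) +
      ENNReal.ofReal M.c • volume.restrict
        {t : ℝ | jumpTime i ω k ≤ t ∧ t < jumpTime i ω (k + 1) ∧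
          b (phase i ω k) ≤ M.startSurplus b i x ω k + M.c * (t - jumpTime i ω k)}

/-- The expected discounted dividends until ruin `f_i(x)` of the phase-wise barrier strategy with
barriers `b`, for the initial phase `i` and the initial surplus `x`. -/
def value (M : RiskModel n) (b : Fin n → ℝ) (i : Fin n) (x : ℝ) : ℝ≥0∞ :=
  ∫⁻ ω, ∫⁻ t in {t : ℝ | (t : EReal) < M.ruinTime b i x ω},
    ENNReal.ofReal (Real.exp (-M.δ * t)) ∂(M.dividends b i x ω) ∂M.law

/-- The barriers `b` are optimal phase-wise barriers: for each phase `i` and each initial surplus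
below `b i`, no other phase-wise barriers have a larger value. -/
def IsOptimal (M : RiskModel n) (b : Fin n → ℝ) : Prop :=
  (∀ i, 0 ≤ b i) ∧
    ∀ b' : Fin n → ℝ, (∀ i, 0 ≤ b' i) →
      ∀ i x, 0 ≤ x → x < b i → M.value b' i x ≤ M.value b i x

end RiskModel

end

/-! Phases 1, 2 of the text are `0`, `1` here; write V_i for the value under the optimal barriers, G
for the value just after a claim, μ_i for `killRate`. Conditioning on the first sojourn and
integrating the dividends by parts gives, with z = x + ct, V_i(x) = ∫ e^{-μ_i t} (μ_i z + γ_i(min(z,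
b_i))) dt, where γ_i = `gain` collects the inflow from jumps minus μ_i y (`value_eq_stepValue`,
`stepValue_value`). The barrier used in the first sojourn enters only through γ_i(min(z, ·)).

Policy improvement: if a barrier B does at least as well in this integrand at every z, and strictly
better at the barrier, then playing B throughout phase i strictly raises the value, since the
one-sojourn operator is monotone and contracts by discounting (`le_value_of_le_stepValue`).
Optimality excludes this (`not_gain_lt_of_isOptimal`), so γ_i'(b_i) = 0 for positive barriers; one
inequality for each phase is enough.

The integral formula also yields c V_i' = μ_i (V_i - x) - γ_i(min(x, b_i)), with V_i' = 1 from b_i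
on, and exponential claims yield G' = β(H - G), H being the value averaged over the restart phase.
On [b_1, b_2], where V_1' = 1, the functions w = V_2' - 1 and g = G' - 1 therefore solve c w' = μ_2
w - λ_23 g + δ, g' = β(π_2 w - g), while γ_1' = λ_12 w + λ_13 g - δ and γ_2' = λ_23 g - δ. At b_2
one has w = 0 and λ_23 g ≥ δ. Followed backwards, the system keeps w ≥ 0 and makes g larger
(`linearSystem_backward`), so g(b_1) > g(b_2) > 0. If λ_13 ≥ λ_23, then γ_1'(b_1) ≥ λ_13 g(b_1) - δ
> λ_23 g(b_2) - δ ≥ 0, against γ_1'(b_1) ≤ 0. -/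

noncomputable section

namespace RiskModel

variable {n : ℕ}

/-! ### The shift of the noise -/

/-- The noise without its first entry. -/
def shift (ω : ℕ → Noise n) : ℕ → Noise n := fun k => ω (k + 1)

/-- The phase entered at the end of a sojourn in phase `i` with noise `a`. -/
def nextPhase (i : Fin n) (a : Noise n) : Fin n :=
  Fin.lastCases (motive := fun _ => Fin n) a.2.2.1 (fun j => j) (a.2.1 i)

/-- The surplus at the end of a sojourn in phase `i` with noise `a` that starts with surplus `x`. -/
def nextSurplus (M : RiskModel n) (b : Fin n → ℝ) (i : Fin n) (x : ℝ) (a : Noise n) : ℝ :=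
  min (x + M.c * a.1 i) (b i) - if a.2.1 i = Fin.last n then a.2.2.2 else 0

lemma phase_succ (i : Fin n) (ω : ℕ → Noise n) (k : ℕ) :
    phase i ω (k + 1) = phase (nextPhase i (ω 0)) (shift ω) k := by
  induction k with
  | zero => rfl
  | succ k ih =>
    rw [phase, ih, phase]
    rfl

lemma holding_succ (i : Fin n) (ω : ℕ → Noise n) (k : ℕ) :
    holding i ω (k + 1) = holding (nextPhase i (ω 0)) (shift ω) k := by
  simp [holding, phase_succ, shift]

lemma claim_succ (i : Fin n) (ω : ℕ → Noise n) (k : ℕ) :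
    claim i ω (k + 1) = claim (nextPhase i (ω 0)) (shift ω) k := by
  simp only [claim, phase_succ]
  rfl

lemma jumpTime_succ (i : Fin n) (ω : ℕ → Noise n) (k : ℕ) :
    jumpTime i ω (k + 1) = (ω 0).1 i + jumpTime (nextPhase i (ω 0)) (shift ω) k := by
  rw [jumpTime, Finset.sum_range_succ', add_comm, jumpTime]
  simp only [holding_succ]
  rfl

lemma startSurplus_succ (M : RiskModel n) (b : Fin n → ℝ) (i : Fin n) (x : ℝ)
    (ω : ℕ → Noise n) (k : ℕ) :
    M.startSurplus b i x ω (k + 1) =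
      M.startSurplus b (nextPhase i (ω 0)) (M.nextSurplus b i x (ω 0)) (shift ω) k := by
  induction k with
  | zero => rfl
  | succ k ih => rw [startSurplus, ih, startSurplus, holding_succ, phase_succ, claim_succ]

lemma measurable_shift : Measurable (shift : (ℕ → Noise n) → ℕ → Noise n) := by
  unfold shift; fun_prop

/-- The first entry and the remaining entries of the noise are independent, and the latter have the
law of the whole noise. -/
lemma map_head_shift (M : RiskModel n) :
    M.law.map (fun ω => (ω 0, shift ω)) = M.stepLaw.prod M.law := by
  let cons : Noise n × (ℕ → Noise n) → ℕ → Noise n := fun p k => Nat.casesOn k p.1 p.2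
  have hcons : Measurable cons := by
    refine measurable_pi_lambda _ fun k => ?_
    cases k with
    | zero => exact measurable_fst
    | succ k => exact (measurable_pi_apply k).comp measurable_snd
  -- Prepending an independent entry reproduces the product law, as seen on cylinders. Since `cons`
  -- is a section of the map that splits off the head, the claim then follows by pushing forward.
  have hlaw : (M.stepLaw.prod M.law).map cons = M.law := by
    refine Measure.eq_infinitePi _ fun s t ht => ?_
    obtain ⟨N, hN⟩ : ∃ N, s ⊆ Finset.range (N + 1) :=
      ⟨s.sup id, fun k hk => Finset.mem_range_succ_iff.2 (Finset.le_sup (f := id) hk)⟩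
    classical
    let t' : ℕ → Set (Noise n) := fun k => if k ∈ s then t k else Set.univ
    have ht' : ∀ k, MeasurableSet (t' k) := fun k => by
      by_cases hk : k ∈ s <;> simp [t', hk, ht]
    have h1 : Set.pi (s : Set ℕ) t = Set.pi (Finset.range (N + 1) : Set ℕ) t' := by
      ext ω
      simp only [Set.mem_pi, Finset.mem_coe]
      refine ⟨fun h k _ => ?_, fun h k hk => by simpa [t', hk] using h k (hN hk)⟩
      by_cases hk : k ∈ s
      · simpa [t', hk] using h k hk
      · simp [t', hk]
    have h2 : ∏ k ∈ s, M.stepLaw (t k) = ∏ k ∈ Finset.range (N + 1), M.stepLaw (t' k) := by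
      rw [← Finset.prod_subset hN]
      · exact Finset.prod_congr rfl fun k hk => by simp [t', hk]
      · intro k _ hk
        simp [t', hk]
    have h3 : cons ⁻¹' Set.pi (Finset.range (N + 1) : Set ℕ) t' =
        t' 0 ×ˢ Set.pi (Finset.range N : Set ℕ) (fun k => t' (k + 1)) := by
      ext p
      simp only [Set.mem_preimage, Set.mem_pi, Finset.mem_coe, Finset.mem_range, Set.mem_prod]
      constructor
      · exact fun h => ⟨h 0 (by omega), fun k hk => h (k + 1) (by omega)⟩
      · rintro ⟨h0, h⟩ (_ | k) hk
        · exact h0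
        · exact h k (by omega)
    rw [h1, h2, Measure.map_apply hcons
      (MeasurableSet.pi (Finset.countable_toSet _) fun k _ => ht' k), h3, Measure.prod_prod, law,
      Measure.infinitePi_pi _ (fun k _ => ht' (k + 1)), Finset.prod_range_succ', mul_comm]
  conv_lhs => rw [← hlaw]
  rw [Measure.map_map ((measurable_pi_apply 0).prodMk measurable_shift) hcons]
  exact Measure.map_id

lemma lintegral_head_shift (M : RiskModel n) {f : Noise n → (ℕ → Noise n) → ℝ≥0∞}
    (hf : Measurable (Function.uncurry f)) :
    ∫⁻ ω, f (ω 0) (shift ω) ∂M.law = ∫⁻ a, ∫⁻ ω, f a ω ∂M.law ∂M.stepLaw := by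
  have h : Measurable fun ω : ℕ → Noise n => (ω 0, shift ω) :=
    (measurable_pi_apply 0).prodMk measurable_shift
  calc ∫⁻ ω, f (ω 0) (shift ω) ∂M.law
      = ∫⁻ p, Function.uncurry f p ∂(M.law.map fun ω => (ω 0, shift ω)) :=
        (lintegral_map hf h).symm
    _ = _ := by rw [map_head_shift, lintegral_prod _ hf.aemeasurable]; rfl

/-! ### The discounted dividends of one sojourn -/

/-- The dividends, discounted to its beginning, of a sojourn of length `h` with barrier `B` that
starts with surplus `x`. -/
def sojournReward (M : RiskModel n) (B x h : ℝ) : ℝ≥0∞ :=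
  ENNReal.ofReal (x - B) + ENNReal.ofReal M.c *
    ∫⁻ t in {t : ℝ | 0 ≤ t ∧ t < h ∧ B ≤ x + M.c * t}, ENNReal.ofReal (Real.exp (-M.δ * t))

lemma measurableSet_sojourn (M : RiskModel n) (B x h : ℝ) :
    MeasurableSet {t : ℝ | 0 ≤ t ∧ t < h ∧ B ≤ x + M.c * t} := by
  measurability

lemma measurable_sojournReward (M : RiskModel n) (B : ℝ) :
    Measurable fun p : ℝ × ℝ => M.sojournReward B p.1 p.2 := by
  unfold sojournReward
  have h0 : Measurable fun p : ℝ × ℝ => ENNReal.ofReal (p.1 - B) := by fun_prop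
  refine h0.add (Measurable.const_mul ?_ _)
  have h : ∀ p : ℝ × ℝ, ∫⁻ t in {t : ℝ | 0 ≤ t ∧ t < p.2 ∧ B ≤ p.1 + M.c * t},
      ENNReal.ofReal (Real.exp (-M.δ * t)) =
      ∫⁻ t, Set.indicator {q : (ℝ × ℝ) × ℝ | 0 ≤ q.2 ∧ q.2 < q.1.2 ∧ B ≤ q.1.1 + M.c * q.2}
        (fun q => ENNReal.ofReal (Real.exp (-M.δ * q.2))) (p, t) := fun p => by
    rw [← lintegral_indicator (M.measurableSet_sojourn _ _ _)]
    rfl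
  simp_rw [h]
  refine Measurable.lintegral_prod_right' (f := Set.indicator
    {q : (ℝ × ℝ) × ℝ | 0 ≤ q.2 ∧ q.2 < q.1.2 ∧ B ≤ q.1.1 + M.c * q.2}
        (fun q => ENNReal.ofReal (Real.exp (-M.δ * q.2)))) ?_
  refine Measurable.indicator (f := fun q : (ℝ × ℝ) × ℝ =>
    ENNReal.ofReal (Real.exp (-M.δ * q.2))) (by fun_prop) ?_
  exact (measurableSet_le (f := fun _ : (ℝ × ℝ) × ℝ => (0 : ℝ)) (g := fun q => q.2)
    (by fun_prop) (by fun_prop)).inter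
    ((measurableSet_lt (f := fun q : (ℝ × ℝ) × ℝ => q.2) (g := fun q => q.1.2)
      (by fun_prop) (by fun_prop)).inter
      (measurableSet_le (f := fun _ : (ℝ × ℝ) × ℝ => B) (g := fun q => q.1.1 + M.c * q.2)
        (by fun_prop) (by fun_prop)))

open Classical in
/-- The discounted dividends of the `k`-th sojourn, `0` if ruin happens before it. -/
def reward (M : RiskModel n) (b : Fin n → ℝ) (i : Fin n) (x : ℝ) (ω : ℕ → Noise n) (k : ℕ) :
    ℝ≥0∞ :=
  if ∀ m ≤ k, 0 ≤ M.startSurplus b i x ω m then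
    ENNReal.ofReal (Real.exp (-M.δ * jumpTime i ω k)) *
      M.sojournReward (b (phase i ω k)) (M.startSurplus b i x ω k) (holding i ω k)
  else 0

lemma reward_zero (M : RiskModel n) (b : Fin n → ℝ) (i : Fin n) (x : ℝ) (ω : ℕ → Noise n) :
    M.reward b i x ω 0 = if 0 ≤ x then M.sojournReward (b i) x ((ω 0).1 i) else 0 := by
  simp [reward, startSurplus, jumpTime, phase, holding]

lemma reward_succ (M : RiskModel n) (b : Fin n → ℝ) (i : Fin n) (x : ℝ) (ω : ℕ → Noise n)
    (k : ℕ) :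
    M.reward b i x ω (k + 1) = if 0 ≤ x then ENNReal.ofReal (Real.exp (-M.δ * (ω 0).1 i)) *
      M.reward b (nextPhase i (ω 0)) (M.nextSurplus b i x (ω 0)) (shift ω) k else 0 := by
  have h : (∀ m ≤ k + 1, 0 ≤ M.startSurplus b i x ω m) ↔ 0 ≤ x ∧ ∀ m ≤ k,
      0 ≤ M.startSurplus b (nextPhase i (ω 0)) (M.nextSurplus b i x (ω 0)) (shift ω) m := by
    simp_rw [← startSurplus_succ]
    refine ⟨fun h => ⟨h 0 (by omega), fun m hm => h (m + 1) (by omega)⟩, ?_⟩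
    rintro ⟨h0, h⟩ (_ | m) hm
    · exact h0
    · exact h m (by omega)
  simp only [reward, h, holding_succ, startSurplus_succ, phase_succ, jumpTime_succ]
  by_cases hx : 0 ≤ x
  · simp only [hx, true_and, if_true]
    split_ifs
    · rw [mul_add, Real.exp_add, ENNReal.ofReal_mul (Real.exp_nonneg _), mul_assoc]
    · simp
  · simp [hx]

lemma reward_of_neg (M : RiskModel n) (b : Fin n → ℝ) (i : Fin n) {x : ℝ} (hx : x < 0)
    (ω : ℕ → Noise n) (k : ℕ) : M.reward b i x ω k = 0 :=
  if_neg fun h => not_le.2 hx (h 0 (Nat.zero_le k))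

lemma measurable_nextPhase (i : Fin n) : Measurable (nextPhase i : Noise n → Fin n) :=
  (measurable_of_finite fun p : Fin (n + 1) × Fin n =>
    Fin.lastCases (motive := fun _ => Fin n) p.2 (fun j => j) p.1).comp
    (f := fun a : Noise n => (a.2.1 i, a.2.2.1)) (by fun_prop)

lemma measurable_nextSurplus (M : RiskModel n) (b : Fin n → ℝ) (i : Fin n) :
    Measurable fun p : ℝ × Noise n => M.nextSurplus b i p.1 p.2 := by
  unfold nextSurplus
  refine Measurable.sub (by fun_prop) (Measurable.ite ?_ (by fun_prop) measurable_const)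
  exact (by fun_prop : Measurable fun p : ℝ × Noise n => p.2.2.1 i) (measurableSet_singleton _)

lemma measurable_reward (M : RiskModel n) (b : Fin n → ℝ) (k : ℕ) :
    Measurable fun p : Fin n × ℝ × (ℕ → Noise n) => M.reward b p.1 p.2.1 p.2.2 k := by
  induction k with
  | zero =>
    refine measurable_from_prod_countable_right fun i => ?_
    simp only [reward_zero]
    refine Measurable.ite (measurableSet_le measurable_const measurable_fst) ?_ measurable_const
    exact (M.measurable_sojournReward (b i)).comp
      (f := fun p : ℝ × (ℕ → Noise n) => (p.1, (p.2 0).1 i)) (by fun_prop)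
  | succ k ih =>
    refine measurable_from_prod_countable_right fun i => ?_
    simp only [reward_succ]
    refine Measurable.ite (measurableSet_le measurable_const measurable_fst) ?_ measurable_const
    refine Measurable.mul (by fun_prop) ?_
    have h0 : Measurable fun p : ℝ × (ℕ → Noise n) => p.2 0 := by fun_prop
    exact ih.comp (((measurable_nextPhase i).comp h0).prodMk
      (((M.measurable_nextSurplus b i).comp (measurable_fst.prodMk h0)).prodMk
        (measurable_shift.comp measurable_snd)))

/-! ### The value as a sum over the sojourns -/

lemma ae_expMeasure_pos {r : ℝ} (hr : 0 < r) : ∀ᵐ x ∂expMeasure r, 0 < x := by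
  have := isProbabilityMeasure_expMeasure hr
  have h := cdf_expMeasure_eq hr 0
  rw [cdf_eq_real] at h
  simp only [le_refl, if_true, mul_zero, neg_zero, Real.exp_zero, sub_self] at h
  rw [ae_iff]
  have h2 : {x : ℝ | ¬ 0 < x} = Set.Iic 0 := by ext; simp
  rw [h2]
  exact (measureReal_eq_zero_iff).1 h

lemma ae_stepLaw_pos (M : RiskModel n) : ∀ᵐ a ∂M.stepLaw, ∀ j, 0 < a.1 j := by
  have := fun i => isProbabilityMeasure_expMeasure (M.rate_pos i)
  have := isProbabilityMeasure_expMeasure M.β_pos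
  rw [ae_all_iff]
  intro j
  have h : MeasurePreserving (fun a : Noise n => a.1 j) M.stepLaw (expMeasure (M.rate j)) :=
    (measurePreserving_eval _ j).comp measurePreserving_fst
  exact h.quasiMeasurePreserving.ae (ae_expMeasure_pos (M.rate_pos j))

lemma ae_law_pos (M : RiskModel n) : ∀ᵐ ω ∂M.law, ∀ k j, 0 < (ω k).1 j := by
  rw [ae_all_iff]
  intro k
  exact (measurePreserving_eval_infinitePi (fun _ : ℕ => M.stepLaw) k).quasiMeasurePreserving.ae
    M.ae_stepLaw_pos

lemma jumpTime_mono (i : Fin n) {ω : ℕ → Noise n} (hω : ∀ k j, 0 < (ω k).1 j) :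
    Monotone (jumpTime i ω) :=
  monotone_nat_of_le_succ fun k => by
    rw [jumpTime, jumpTime, Finset.sum_range_succ]
    have := hω k (phase i ω k)
    simp only [holding]
    linarith

/-- Within a sojourn the surplus is the minimum of an increasing function and a nonnegative barrier,
so it can be negative only if the sojourn started with negative surplus. -/
lemma le_ruinTime (M : RiskModel n) {b : Fin n → ℝ} (hb : ∀ i, 0 ≤ b i) (i : Fin n) (x : ℝ)
    {ω : ℕ → Noise n} (hω : ∀ k j, 0 < (ω k).1 j) {k : ℕ}
    (h : ∀ m ≤ k, 0 ≤ M.startSurplus b i x ω m) :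
    (jumpTime i ω (k + 1) : EReal) ≤ M.ruinTime b i x ω := by
  refine le_sInf ?_
  rintro _ ⟨m, u, hu0, -, hs, rfl⟩
  have hm : k + 1 ≤ m := by
    by_contra! hm
    have h1 := h m (by omega)
    have h2 := mul_nonneg M.c_pos.le hu0
    rw [surplus, min_lt_iff] at hs
    rcases hs with hs | hs
    · linarith
    · exact absurd hs (not_lt.2 (hb _))
  have := jumpTime_mono i hω hm
  exact_mod_cast (by linarith : jumpTime i ω (k + 1) ≤ jumpTime i ω m + u)

/-- A sojourn that starts with negative surplus witnesses ruin at its very beginning; positivity of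
the holding time makes `u = 0` admissible. -/
lemma ruinTime_le (M : RiskModel n) (b : Fin n → ℝ) (i : Fin n) (x : ℝ)
    {ω : ℕ → Noise n} (hω : ∀ k j, 0 < (ω k).1 j) {k m : ℕ} (hm : m ≤ k)
    (h : M.startSurplus b i x ω m < 0) :
    M.ruinTime b i x ω ≤ (jumpTime i ω k : EReal) := by
  have hs : M.surplus b i x ω m 0 < 0 := by
    rw [surplus, mul_zero, add_zero]
    exact (min_le_left _ _).trans_lt h
  rw [ruinTime]
  refine sInf_le_of_le (b := ((jumpTime i ω m + 0 : ℝ) : EReal)) ?_ ?_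
  · exact ⟨m, 0, le_rfl, hω m _, hs, rfl⟩
  rw [add_zero]
  exact_mod_cast jumpTime_mono i hω hm

/-- The discounted dividends until ruin are the sum of those of the sojourns. -/
lemma lintegral_dividends (M : RiskModel n) {b : Fin n → ℝ} (hb : ∀ i, 0 ≤ b i) (i : Fin n) (x : ℝ)
    {ω : ℕ → Noise n} (hω : ∀ k j, 0 < (ω k).1 j) :
    ∫⁻ t in {t : ℝ | (t : EReal) < M.ruinTime b i x ω},
      ENNReal.ofReal (Real.exp (-M.δ * t)) ∂(M.dividends b i x ω) =
    ∑' k, M.reward b i x ω k := by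
  have hR : MeasurableSet {t : ℝ | (t : EReal) < M.ruinTime b i x ω} :=
    measurableSet_lt measurable_coe_real_ereal measurable_const
  have hf : Measurable fun t : ℝ => ENNReal.ofReal (Real.exp (-M.δ * t)) := by fun_prop
  rw [← lintegral_indicator hR, dividends, lintegral_sum_measure]
  refine tsum_congr fun k => ?_
  have hT : jumpTime i ω (k + 1) = jumpTime i ω k + holding i ω k := by
    rw [jumpTime, Finset.sum_range_succ, jumpTime]
  have hh : 0 < holding i ω k := hω k _
  set T := jumpTime i ω k with hTdef
  set S := M.startSurplus b i x ω k
  set B := b (phase i ω k)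
  have hA : MeasurableSet {t : ℝ | T ≤ t ∧ t < jumpTime i ω (k + 1) ∧ B ≤ S + M.c * (t - T)} := by
    measurability
  rw [lintegral_add_measure, lintegral_smul_measure, lintegral_smul_measure,
    lintegral_dirac' _ (hf.indicator hR), smul_eq_mul, smul_eq_mul]
  by_cases h : ∀ m ≤ k, 0 ≤ M.startSurplus b i x ω m
  · have hr : ∀ t, t < jumpTime i ω (k + 1) → t ∈ {t : ℝ | (t : EReal) < M.ruinTime b i x ω} :=
      fun t ht => lt_of_lt_of_le (by exact_mod_cast ht) (M.le_ruinTime hb i x hω h)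
    rw [Set.indicator_of_mem (hr T (by linarith)), reward, if_pos h, sojournReward, mul_add,
      mul_comm (ENNReal.ofReal (S - B))]
    congr 1
    rw [mul_left_comm]
    congr 1
    -- Every time of the sojourn precedes ruin, so the cut-off disappears; translating by `T` then
    -- restarts the clock and leaves the factor e^{-δT}.
    rw [setLIntegral_congr_fun hA (g := fun t => ENNReal.ofReal (Real.exp (-M.δ * t)))
      (fun t ht => Set.indicator_of_mem (hr t ht.2.1) _), ← lintegral_indicator hA,
      ← lintegral_add_right_eq_self _ T, ← lintegral_const_mul _ hf,
      ← lintegral_indicator (M.measurableSet_sojourn _ _ _)]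
    refine lintegral_congr fun t => ?_
    simp only [Set.indicator, Set.mem_ofPred_eq, hT, add_comm t T, add_lt_add_iff_left,
      le_add_iff_nonneg_right, add_sub_cancel_left]
    split_ifs
    · rw [← ENNReal.ofReal_mul (Real.exp_nonneg _), ← Real.exp_add, mul_add]
    · rfl
  · rw [reward, if_neg h]
    push Not at h
    obtain ⟨m, hm, hneg⟩ := h
    have hr : ∀ t, T ≤ t → t ∉ {t : ℝ | (t : EReal) < M.ruinTime b i x ω} := fun t ht h' =>
      absurd (lt_of_lt_of_le h' (M.ruinTime_le b i x hω hm hneg))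
        (not_lt.2 (by exact_mod_cast ht))
    rw [Set.indicator_of_notMem (hr T le_rfl), setLIntegral_congr_fun hA (g := fun _ => 0)
      (fun t ht => Set.indicator_of_notMem (hr t ht.1) _)]
    simp

/-- The expected discounted dividends of the `k`-th sojourn. -/
def expReward (M : RiskModel n) (b : Fin n → ℝ) (k : ℕ) (i : Fin n) (x : ℝ) : ℝ≥0∞ :=
  ∫⁻ ω, M.reward b i x ω k ∂M.law

lemma measurable_expReward (M : RiskModel n) (b : Fin n → ℝ) (k : ℕ) (i : Fin n) :
    Measurable (M.expReward b k i) :=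
  Measurable.lintegral_prod_right' (f := fun p : ℝ × (ℕ → Noise n) => M.reward b i p.1 p.2 k)
    ((M.measurable_reward b k).comp measurable_prodMk_left)

lemma value_eq_tsum (M : RiskModel n) {b : Fin n → ℝ} (hb : ∀ i, 0 ≤ b i) (i : Fin n) (x : ℝ) :
    M.value b i x = ∑' k, M.expReward b k i x := by
  rw [value, lintegral_congr_ae (M.ae_law_pos.mono fun ω hω => M.lintegral_dividends hb i x hω),
    lintegral_tsum]
  · rfl
  · intro k
    exact ((M.measurable_reward b k).comp
      (f := fun ω : ℕ → Noise n => (i, x, ω)) (by fun_prop)).aemeasurable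

lemma measurable_value (M : RiskModel n) {b : Fin n → ℝ} (hb : ∀ i, 0 ≤ b i) (i : Fin n) :
    Measurable (M.value b i) := by
  rw [funext (M.value_eq_tsum hb i)]
  exact Measurable.tsum fun k => M.measurable_expReward b k i

/-- The expected discounted dividends when the first sojourn is followed by the value `F`. -/
def stepValue (M : RiskModel n) (b : Fin n → ℝ) (F : Fin n → ℝ → ℝ≥0∞) (i : Fin n) (x : ℝ) :
    ℝ≥0∞ :=
  ∫⁻ a, M.sojournReward (b i) x (a.1 i) + ENNReal.ofReal (Real.exp (-M.δ * a.1 i)) *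
    F (nextPhase i a) (M.nextSurplus b i x a) ∂M.stepLaw

lemma measurable_nextValue (M : RiskModel n) (b : Fin n → ℝ) {F : Fin n → ℝ → ℝ≥0∞}
    (hF : ∀ i, Measurable (F i)) (i : Fin n) (x : ℝ) :
    Measurable fun a : Noise n => ENNReal.ofReal (Real.exp (-M.δ * a.1 i)) *
      F (nextPhase i a) (M.nextSurplus b i x a) := by
  have h : Measurable (Function.uncurry F) := measurable_from_prod_countable_right hF
  refine Measurable.mul (by fun_prop) ?_
  exact h.comp ((measurable_nextPhase i).prodMk
    ((M.measurable_nextSurplus b i).comp measurable_prodMk_left))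

lemma measurable_sojournReward_noise (M : RiskModel n) (B x : ℝ) (i : Fin n) :
    Measurable fun a : Noise n => M.sojournReward B x (a.1 i) :=
  (M.measurable_sojournReward B).comp (f := fun a : Noise n => (x, a.1 i)) (by fun_prop)

lemma expReward_of_neg (M : RiskModel n) (b : Fin n → ℝ) (k : ℕ) (i : Fin n) {x : ℝ} (hx : x < 0) :
    M.expReward b k i x = 0 := by
  simp [expReward, M.reward_of_neg b i hx]

lemma value_of_neg (M : RiskModel n) {b : Fin n → ℝ} (hb : ∀ i, 0 ≤ b i) (i : Fin n) {x : ℝ}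
    (hx : x < 0) : M.value b i x = 0 := by
  simp [M.value_eq_tsum hb, M.expReward_of_neg b _ i hx]

lemma expReward_zero (M : RiskModel n) (b : Fin n → ℝ) (i : Fin n) {x : ℝ} (hx : 0 ≤ x) :
    M.expReward b 0 i x = ∫⁻ a, M.sojournReward (b i) x (a.1 i) ∂M.stepLaw := by
  simp only [expReward, reward_zero, if_pos hx]
  exact (measurePreserving_eval_infinitePi (fun _ : ℕ => M.stepLaw) 0).lintegral_comp
    (M.measurable_sojournReward_noise (b i) x i)

lemma expReward_succ (M : RiskModel n) (b : Fin n → ℝ) (k : ℕ) (i : Fin n) {x : ℝ} (hx : 0 ≤ x) :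
    M.expReward b (k + 1) i x = ∫⁻ a, ENNReal.ofReal (Real.exp (-M.δ * a.1 i)) *
      M.expReward b k (nextPhase i a) (M.nextSurplus b i x a) ∂M.stepLaw := by
  simp only [expReward, reward_succ, if_pos hx]
  have hm : Measurable fun p : Noise n × (ℕ → Noise n) =>
      M.reward b (nextPhase i p.1) (M.nextSurplus b i x p.1) p.2 k :=
    (M.measurable_reward b k).comp (((measurable_nextPhase i).comp measurable_fst).prodMk
      ((((M.measurable_nextSurplus b i).comp measurable_prodMk_left).comp
        measurable_fst).prodMk measurable_snd))
  rw [M.lintegral_head_shift (f := fun a ω => ENNReal.ofReal (Real.exp (-M.δ * a.1 i)) *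
      M.reward b (nextPhase i a) (M.nextSurplus b i x a) ω k)]
  · exact lintegral_congr fun a => lintegral_const_mul _ (hm.comp measurable_prodMk_left)
  · exact Measurable.mul (by fun_prop) hm

/-- The expected discounted dividends of the first `N` sojourns. -/
def partialValue (M : RiskModel n) (b : Fin n → ℝ) (N : ℕ) (i : Fin n) (x : ℝ) : ℝ≥0∞ :=
  ∑ k ∈ Finset.range N, M.expReward b k i x

lemma partialValue_succ (M : RiskModel n) (b : Fin n → ℝ) (N : ℕ) (i : Fin n) {x : ℝ}
    (hx : 0 ≤ x) :
    M.partialValue b (N + 1) i x = M.stepValue b (M.partialValue b N) i x := by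
  rw [partialValue, Finset.sum_range_succ', add_comm, stepValue,
    lintegral_add_left (M.measurable_sojournReward_noise (b i) x i), M.expReward_zero b i hx]
  simp_rw [partialValue, Finset.mul_sum, M.expReward_succ b _ i hx]
  rw [lintegral_finsetSum _ fun k _ => M.measurable_nextValue b (M.measurable_expReward b k) i x]

/-- The value is a fixed point of the one-sojourn operator. -/
lemma value_eq_stepValue (M : RiskModel n) {b : Fin n → ℝ} (hb : ∀ i, 0 ≤ b i) (i : Fin n) {x : ℝ}
    (hx : 0 ≤ x) : M.value b i x = M.stepValue b (M.value b) i x := by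
  have h : M.value b = fun i x => ∑' k, M.expReward b k i x := by
    ext i x
    exact M.value_eq_tsum hb i x
  rw [stepValue, lintegral_add_left (M.measurable_sojournReward_noise (b i) x i), h]
  simp only
  rw [tsum_eq_zero_add' ENNReal.summable, M.expReward_zero b i hx]
  simp_rw [← ENNReal.tsum_mul_left, M.expReward_succ b _ i hx]
  rw [lintegral_tsum fun k =>
    (M.measurable_nextValue b (M.measurable_expReward b k) i x).aemeasurable]

/-! ### The value grows at most linearly -/

lemma setLIntegral_exp_Ico {δ : ℝ} (hδ : 0 < δ) {s h : ℝ} (hsh : s ≤ h) :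
    ∫⁻ t in Set.Ico s h, ENNReal.ofReal (Real.exp (-δ * t)) =
      ENNReal.ofReal ((Real.exp (-δ * s) - Real.exp (-δ * h)) / δ) := by
  have hd : ∀ t ∈ Set.uIcc s h, HasDerivAt (fun t => -(Real.exp (-δ * t) / δ))
      (Real.exp (-δ * t)) t := fun t _ => by
    have h1 : HasDerivAt (fun t : ℝ => -δ * t) (-δ) t := by
      simpa using (hasDerivAt_id t).const_mul (-δ)
    refine (h1.exp.div_const δ).neg.congr_deriv ?_
    field_simp
  have hc : Continuous fun t : ℝ => Real.exp (-δ * t) := by fun_prop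
  rw [setLIntegral_congr (Ico_ae_eq_Ioc), ← ofReal_integral_eq_lintegral_ofReal
    ((hc.intervalIntegrable s h).1) (Filter.Eventually.of_forall fun t => (Real.exp_nonneg _)),
    ← intervalIntegral.integral_of_le hsh,
    intervalIntegral.integral_eq_sub_of_hasDerivAt hd (hc.intervalIntegrable s h)]
  congr 1
  ring

/-- The supermartingale property of x + c/δ, the current surplus plus the discounted value of all
future premiums: delaying a payment only loses by discounting. -/
lemma sojournReward_add_le (M : RiskModel n) {B x h : ℝ} (hB : 0 ≤ B) (hx : 0 ≤ x) (hh : 0 ≤ h) :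
    M.sojournReward B x h + ENNReal.ofReal (Real.exp (-M.δ * h)) *
      ENNReal.ofReal (min (x + M.c * h) B + M.c / M.δ) ≤ ENNReal.ofReal (x + M.c / M.δ) := by
  have hc := M.c_pos
  have hδ := M.δ_pos
  have hcδ : 0 < M.c / M.δ := div_pos hc hδ
  have hmin : 0 ≤ min (x + M.c * h) B := le_min (by positivity) hB
  -- Here `s` is a lower bound for the time at which premiums begin to be paid out. The terms
  -- (c/δ)e^{-δh} of the premiums paid and of the continuation cancel, which leaves a real
  -- inequality.
  have key : ∀ s, 0 ≤ s → s ≤ h → {t : ℝ | 0 ≤ t ∧ t < h ∧ B ≤ x + M.c * t} ⊆ Set.Ico s h →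
      max (x - B) 0 + M.c / M.δ * Real.exp (-M.δ * s) +
        Real.exp (-M.δ * h) * min (x + M.c * h) B ≤ x + M.c / M.δ →
      M.sojournReward B x h + ENNReal.ofReal (Real.exp (-M.δ * h)) *
        ENNReal.ofReal (min (x + M.c * h) B + M.c / M.δ) ≤ ENNReal.ofReal (x + M.c / M.δ) := by
    intro s hs0 hsh hsub hle
    have hexp : Real.exp (-M.δ * h) ≤ Real.exp (-M.δ * s) := Real.exp_le_exp.2 (by nlinarith)
    calc _ ≤ ENNReal.ofReal (x - B) + ENNReal.ofReal M.c *
          ENNReal.ofReal ((Real.exp (-M.δ * s) - Real.exp (-M.δ * h)) / M.δ) +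
          ENNReal.ofReal (Real.exp (-M.δ * h)) *
            ENNReal.ofReal (min (x + M.c * h) B + M.c / M.δ) := by
          rw [sojournReward, ← setLIntegral_exp_Ico hδ hsh]
          gcongr
      _ = ENNReal.ofReal (max (x - B) 0 +
          M.c * ((Real.exp (-M.δ * s) - Real.exp (-M.δ * h)) / M.δ) +
          Real.exp (-M.δ * h) * (min (x + M.c * h) B + M.c / M.δ)) := by
          have h0 : 0 ≤ (Real.exp (-M.δ * s) - Real.exp (-M.δ * h)) / M.δ :=
            div_nonneg (by linarith) hδ.le
          have h1 : ENNReal.ofReal (x - B) = ENNReal.ofReal (max (x - B) 0) := by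
            rcases le_total (x - B) 0 with h | h
            · rw [max_eq_right h, ENNReal.ofReal_zero, ENNReal.ofReal_of_nonpos h]
            · rw [max_eq_left h]
          rw [h1, ← ENNReal.ofReal_mul hc.le, ← ENNReal.ofReal_mul (Real.exp_nonneg _),
            ← ENNReal.ofReal_add (by positivity) (by positivity),
            ← ENNReal.ofReal_add (by positivity) (by positivity)]
      _ ≤ _ := by
          refine ENNReal.ofReal_le_ofReal (le_of_eq_of_le ?_ hle)
          field_simp
          ring
  rcases le_total B x with hBx | hxB
  · refine key 0 le_rfl hh (fun t ht => ⟨ht.1, ht.2.1⟩) ?_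
    have h1 : min (x + M.c * h) B = B := min_eq_right (by nlinarith [mul_nonneg hc.le hh])
    have h2 : Real.exp (-M.δ * h) ≤ 1 := Real.exp_le_one_iff.2 (by nlinarith)
    rw [h1, max_eq_left (by linarith), mul_zero, Real.exp_zero]
    nlinarith
  · have hs0 : 0 ≤ (B - x) / M.c := div_nonneg (by linarith) hc.le
    have hcs : M.c * ((B - x) / M.c) = B - x := by field_simp
    refine key (min h ((B - x) / M.c)) (le_min hh hs0) (min_le_left _ _) (fun t ht => ⟨?_, ht.2.1⟩) ?_
    · refine (min_le_right _ _).trans ?_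
      rw [div_le_iff₀ hc]
      linarith [ht.2.2]
    · have h1 : min (x + M.c * h) B = x + M.c * min h ((B - x) / M.c) := by
        rw [mul_min_of_nonneg _ _ hc.le, hcs, ← min_add_add_left]
        congr 1
        ring
      set s := min h ((B - x) / M.c) with hs
      have hs1 : 0 ≤ s := le_min hh hs0
      have hsh : s ≤ h := min_le_left _ _
      have hexp : Real.exp (-M.δ * h) ≤ Real.exp (-M.δ * s) := Real.exp_le_exp.2 (by nlinarith)
      have hexp1 : Real.exp (-M.δ * s) ≤ 1 := Real.exp_le_one_iff.2 (by nlinarith)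
      -- Saving premiums for a time s and cashing them at once is worth no more than collecting them
      -- as they come: e^{-δs}(1 + δs) ≤ 1.
      have hexp2 : Real.exp (-M.δ * s) * (1 + M.δ * s) ≤ 1 := by
        have h3 := Real.add_one_le_exp (M.δ * s)
        have h4 : Real.exp (-M.δ * s) * Real.exp (M.δ * s) = 1 := by
          rw [← Real.exp_add]; simp
        have h5 := mul_le_mul_of_nonneg_left h3 (Real.exp_nonneg (-M.δ * s))
        linarith
      rw [h1, max_eq_right (by linarith)]
      have h6 : Real.exp (-M.δ * h) * (x + M.c * s) ≤ Real.exp (-M.δ * s) * (x + M.c * s) :=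
        mul_le_mul_of_nonneg_right hexp (by positivity)
      have h7 : Real.exp (-M.δ * s) * x ≤ x := by nlinarith
      have h8 := mul_le_mul_of_nonneg_left hexp2 hcδ.le
      have h9 : M.c / M.δ * (Real.exp (-M.δ * s) * (1 + M.δ * s)) =
        M.c / M.δ * Real.exp (-M.δ * s) + Real.exp (-M.δ * s) * (M.c * s) := by field_simp
      linarith

lemma ae_stepLaw_claim_pos (M : RiskModel n) : ∀ᵐ a ∂M.stepLaw, 0 < a.2.2.2 := by
  have := fun i => isProbabilityMeasure_expMeasure (M.rate_pos i)
  have := isProbabilityMeasure_expMeasure M.β_pos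
  have h : MeasurePreserving (fun a : Noise n => a.2.2.2) M.stepLaw (expMeasure M.β) :=
    measurePreserving_snd.comp (measurePreserving_snd.comp measurePreserving_snd)
  exact h.quasiMeasurePreserving.ae (ae_expMeasure_pos M.β_pos)

lemma stepValue_le (M : RiskModel n) {b : Fin n → ℝ} (hb : ∀ i, 0 ≤ b i) {F : Fin n → ℝ → ℝ≥0∞}
    (hF : ∀ i x, 0 ≤ x → F i x ≤ ENNReal.ofReal (x + M.c / M.δ)) (hF0 : ∀ i x, x < 0 → F i x = 0)
    (i : Fin n) {x : ℝ} (hx : 0 ≤ x) :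
    M.stepValue b F i x ≤ ENNReal.ofReal (x + M.c / M.δ) := by
  have h : ∀ᵐ a ∂M.stepLaw, M.sojournReward (b i) x (a.1 i) +
      ENNReal.ofReal (Real.exp (-M.δ * a.1 i)) * F (nextPhase i a) (M.nextSurplus b i x a) ≤
      ENNReal.ofReal (x + M.c / M.δ) := by
    filter_upwards [M.ae_stepLaw_pos, M.ae_stepLaw_claim_pos] with a ha ha2
    refine le_trans ?_ (M.sojournReward_add_le (hb i) hx (ha i).le)
    gcongr
    rcases lt_or_ge (M.nextSurplus b i x a) 0 with h | h
    · rw [hF0 _ _ h]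
      exact zero_le
    · refine (hF _ _ h).trans (ENNReal.ofReal_le_ofReal ?_)
      have h2 : 0 ≤ if a.2.1 i = Fin.last n then a.2.2.2 else 0 := by
        split_ifs
        · exact ha2.le
        · exact le_rfl
      simp only [nextSurplus]
      linarith
  exact (lintegral_mono_ae h).trans (by simp)

lemma value_le (M : RiskModel n) {b : Fin n → ℝ} (hb : ∀ i, 0 ≤ b i) (i : Fin n) {x : ℝ}
    (hx : 0 ≤ x) : M.value b i x ≤ ENNReal.ofReal (x + M.c / M.δ) := by
  have h : ∀ N i x, 0 ≤ x → M.partialValue b N i x ≤ ENNReal.ofReal (x + M.c / M.δ) := by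
    intro N
    induction N with
    | zero => intro i x _; simp [partialValue]
    | succ N ih =>
      intro i x hx
      rw [partialValue_succ _ _ _ _ hx]
      refine M.stepValue_le hb ih (fun i x hx => ?_) i hx
      simp [partialValue, M.expReward_of_neg b _ i hx]
  rw [M.value_eq_tsum hb]
  exact ENNReal.summable.tsum_le_of_sum_range_le fun N => h N i x hx

/-! ### Comparison with the fixed point -/

/-- The discount factor at the end of the first sojourn. -/
def meanDiscount (M : RiskModel n) (i : Fin n) : ℝ≥0∞ :=
  ∫⁻ a, ENNReal.ofReal (Real.exp (-M.δ * a.1 i)) ∂M.stepLaw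

lemma meanDiscount_lt_one (M : RiskModel n) (i : Fin n) : M.meanDiscount i < 1 := by
  have h : ∀ᵐ a ∂M.stepLaw, ENNReal.ofReal (Real.exp (-M.δ * a.1 i)) < 1 := by
    filter_upwards [M.ae_stepLaw_pos] with a ha
    rw [ENNReal.ofReal_lt_one, Real.exp_lt_one_iff]
    have := mul_pos M.δ_pos (ha i)
    linarith
  have h1 : ∫⁻ _, (1 : ℝ≥0∞) ∂M.stepLaw = 1 := by simp
  have hle : M.meanDiscount i ≤ 1 :=
    (lintegral_mono_ae (h.mono fun a ha => ha.le)).trans h1.le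
  exact (lintegral_strict_mono (IsProbabilityMeasure.ne_zero _) aemeasurable_const
    (ne_top_of_le_ne_top ENNReal.one_ne_top hle) h).trans_eq h1

lemma stepValue_mono (M : RiskModel n) (b : Fin n → ℝ) {F G : Fin n → ℝ → ℝ≥0∞}
    (h : ∀ i x, F i x ≤ G i x) (i : Fin n) (x : ℝ) :
    M.stepValue b F i x ≤ M.stepValue b G i x :=
  lintegral_mono fun a => by
    gcongr
    exact h _ _

/-- A constant error shrinks by the mean discount factor. Errors are added rather than subtracted
because the values lie in `ℝ≥0∞`. -/
lemma stepValue_add_const (M : RiskModel n) (b : Fin n → ℝ) {F : Fin n → ℝ → ℝ≥0∞}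
    (hF : ∀ i, Measurable (F i)) (d : ℝ≥0∞) (i : Fin n) (x : ℝ) :
    M.stepValue b (fun i x => F i x + d) i x = M.stepValue b F i x + M.meanDiscount i * d := by
  simp only [stepValue, mul_add, ← add_assoc]
  have hm : Measurable fun a : Noise n => M.sojournReward (b i) x (a.1 i) +
      ENNReal.ofReal (Real.exp (-M.δ * a.1 i)) * F (nextPhase i a) (M.nextSurplus b i x a) :=
    (M.measurable_sojournReward_noise (b i) x i).add (M.measurable_nextValue b hF i x)
  rw [lintegral_add_left hm, lintegral_mul_const _ (by fun_prop), meanDiscount]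

/-- The initial lump sum alone. Together with the upper bound x + c/δ it keeps the difference of two
such functions bounded, although each grows linearly. -/
lemma ofReal_sub_le_value (M : RiskModel n) {b : Fin n → ℝ} (hb : ∀ i, 0 ≤ b i) (i : Fin n) {x : ℝ}
    (hx : 0 ≤ x) : ENNReal.ofReal (x - b i) ≤ M.value b i x := by
  rw [M.value_eq_stepValue hb i hx, stepValue]
  calc ENNReal.ofReal (x - b i) = ∫⁻ _, ENNReal.ofReal (x - b i) ∂M.stepLaw := by simp
    _ ≤ _ := lintegral_mono fun a => by
      rw [sojournReward, add_assoc]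
      exact le_self_add

/-- A function below its image under the one-sojourn operator of a barrier strategy is below the
value of this strategy. -/
lemma le_value_of_le_stepValue (M : RiskModel n) {b : Fin n → ℝ} (hb : ∀ i, 0 ≤ b i)
    {F : Fin n → ℝ → ℝ≥0∞} (hF : ∀ i x, 0 ≤ x → F i x ≤ ENNReal.ofReal (x + M.c / M.δ))
    (hF0 : ∀ i x, x < 0 → F i x = 0) (h : ∀ i x, 0 ≤ x → F i x ≤ M.stepValue b F i x)
    (i : Fin n) (x : ℝ) : F i x ≤ M.value b i x := by
  set ρ : ℝ≥0∞ := Finset.univ.sup M.meanDiscount with hρ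
  have hρ1 : ρ < 1 := (Finset.sup_lt_iff zero_lt_one).2 fun i _ => M.meanDiscount_lt_one i
  -- Chosen so that x + c/δ ≤ (x - b i) + d for every phase: the initial error of the iteration.
  set d : ℝ≥0∞ := ENNReal.ofReal (∑ i, b i + M.c / M.δ)
  have hk : ∀ k : ℕ, ∀ i x, F i x ≤ M.value b i x + ρ ^ k * d := by
    intro k
    induction k with
    | zero =>
      intro i x
      rcases lt_or_ge x 0 with hx | hx
      · rw [hF0 i x hx]
        exact zero_le
      · have h1 : b i ≤ ∑ i, b i :=
          Finset.single_le_sum (f := b) (fun i _ => hb i) (Finset.mem_univ i)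
        calc F i x ≤ ENNReal.ofReal (x + M.c / M.δ) := hF i x hx
          _ ≤ ENNReal.ofReal ((x - b i) + (∑ i, b i + M.c / M.δ)) :=
            ENNReal.ofReal_le_ofReal (by linarith)
          _ ≤ ENNReal.ofReal (x - b i) + d := ENNReal.ofReal_add_le
          _ ≤ _ := by
            rw [pow_zero, one_mul]
            gcongr
            exact M.ofReal_sub_le_value hb i hx
    | succ k ih =>
      intro i x
      rcases lt_or_ge x 0 with hx | hx
      · rw [hF0 i x hx]
        exact zero_le
      · calc F i x ≤ M.stepValue b F i x := h i x hx
          _ ≤ M.stepValue b (fun i x => M.value b i x + ρ ^ k * d) i x := M.stepValue_mono b ih i x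
          _ = M.value b i x + M.meanDiscount i * (ρ ^ k * d) := by
            rw [M.stepValue_add_const b (M.measurable_value hb), ← M.value_eq_stepValue hb i hx]
          _ ≤ _ := by
            rw [pow_succ', mul_assoc]
            gcongr
            exact Finset.le_sup (Finset.mem_univ i)
  have hlim : Filter.Tendsto (fun k : ℕ => M.value b i x + ρ ^ k * d) Filter.atTop
      (nhds (M.value b i x + 0 * d)) :=
    Filter.Tendsto.const_add _ (ENNReal.Tendsto.mul_const
      (ENNReal.tendsto_pow_atTop_nhds_zero_of_lt_one hρ1) (Or.inr ENNReal.ofReal_ne_top))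
  simpa using ge_of_tendsto' hlim fun k => hk k i x

/-! ### The one-sojourn operator as an integral over time -/

lemma lintegral_expMeasure (r : ℝ) {f : ℝ → ℝ≥0∞} (hf : Measurable f) :
    ∫⁻ t, f t ∂expMeasure r =
      ∫⁻ t in Set.Ioi 0, ENNReal.ofReal (r * Real.exp (-r * t)) * f t := by
  have hm : Measurable (exponentialPDF r) := (measurable_exponentialPDFReal r).ennreal_ofReal
  have h : ∫⁻ t, f t ∂expMeasure r = ∫⁻ t, exponentialPDF r t * f t :=
    lintegral_withDensity_eq_lintegral_mul _ hm hf
  rw [h, setLIntegral_congr Ioi_ae_eq_Ici, ← lintegral_indicator measurableSet_Ici]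
  refine lintegral_congr fun t => ?_
  rw [exponentialPDF_eq]
  by_cases ht : 0 ≤ t
  · rw [if_pos ht, Set.indicator_of_mem (Set.mem_Ici.2 ht), neg_mul]
  · rw [if_neg ht, Set.indicator_of_notMem (by simpa using ht)]
    simp

lemma expMeasure_Ioi {r : ℝ} (hr : 0 < r) {t : ℝ} (ht : 0 ≤ t) :
    expMeasure r (Set.Ioi t) = ENNReal.ofReal (Real.exp (-r * t)) := by
  have := isProbabilityMeasure_expMeasure hr
  have h := cdf_expMeasure_eq hr t
  rw [cdf_eq_real, if_pos ht] at h
  rw [← ofReal_measureReal, ← Set.compl_Iic, measureReal_compl measurableSet_Iic, h]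
  simp

lemma lintegral_exp_Ioi {μ c : ℝ} (hμ : 0 < μ) (hc : 0 < c) {z s : ℝ} (hz : 0 ≤ z + c * s) :
    ∫⁻ t in Set.Ioi s, ENNReal.ofReal (Real.exp (-μ * t) * (μ * (z + c * t))) =
      ENNReal.ofReal (Real.exp (-μ * s) * (z + c * s + c / μ)) := by
  -- Integration by parts is replaced by an explicit antiderivative.
  have hd : ∀ t ∈ Set.Ici s, HasDerivAt (fun t => -(Real.exp (-μ * t) * (z + c * t + c / μ)))
      (Real.exp (-μ * t) * (μ * (z + c * t))) t := fun t _ => by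
    have h1 : HasDerivAt (fun t : ℝ => -μ * t) (-μ) t := by
      simpa using (hasDerivAt_id t).const_mul (-μ)
    have h2 : HasDerivAt (fun t : ℝ => z + c * t + c / μ) c t := by
      simpa using (((hasDerivAt_id t).const_mul c).const_add z).add_const (c / μ)
    refine (h1.exp.mul h2).neg.congr_deriv ?_
    field_simp
    ring
  have hpos : ∀ t ∈ Set.Ioi s, 0 ≤ Real.exp (-μ * t) * (μ * (z + c * t)) := fun t ht => by
    have : 0 ≤ z + c * t := by nlinarith [mul_pos hc (sub_pos.2 (Set.mem_Ioi.1 ht))]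
    positivity
  have hlim : Filter.Tendsto (fun t => -(Real.exp (-μ * t) * (z + c * t + c / μ))) Filter.atTop
      (nhds 0) := by
    have e1 : Filter.Tendsto (fun t : ℝ => Real.exp (-μ * t)) Filter.atTop (nhds 0) := by
      simpa using tendsto_rpow_mul_exp_neg_mul_atTop_nhds_zero 0 μ hμ
    have e2 : Filter.Tendsto (fun t : ℝ => t * Real.exp (-μ * t)) Filter.atTop (nhds 0) := by
      simpa using tendsto_rpow_mul_exp_neg_mul_atTop_nhds_zero 1 μ hμ
    have := ((e1.mul_const (z + c / μ)).add (e2.const_mul c)).neg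
    simp only [zero_mul, mul_zero, add_zero, neg_zero] at this
    refine this.congr fun t => ?_
    ring
  have hint := integrableOn_Ioi_deriv_of_nonneg' hd hpos hlim
  rw [← ofReal_integral_eq_lintegral_ofReal hint
    ((ae_restrict_iff' measurableSet_Ioi).2 (Filter.Eventually.of_forall hpos)),
    integral_Ioi_of_hasDerivAt_of_nonneg' hd hpos hlim]
  simp

/-- The cumulative dividends of an endless sojourn are D_t = z - min(z, B) with z = x + ct. This is
the integration by parts ∫ e^{-μt} dD_t = ∫ μ e^{-μt} D_t dt, the lump sum being the atom at 0. -/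
lemma lintegral_excess {μ c : ℝ} (hμ : 0 < μ) (hc : 0 < c) (x B : ℝ) :
    ENNReal.ofReal (x - B) +
      ∫⁻ t in Set.Ioi 0 ∩ {t | B ≤ x + c * t}, ENNReal.ofReal (c * Real.exp (-μ * t)) =
    ∫⁻ t in Set.Ioi 0, ENNReal.ofReal
      (Real.exp (-μ * t) * (μ * (x + c * t - min (x + c * t) B))) := by
  -- The first time at which the surplus, growing at rate `c`, has reached `B`.
  set s := max 0 ((B - x) / c) with hs
  have hs0 : 0 ≤ s := le_max_left _ _
  have hcs : c * s = max 0 (B - x) := by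
    rw [hs, mul_max_of_nonneg _ _ hc.le, mul_zero]
    congr 1
    field_simp
  have hle : ∀ t, s ≤ t ↔ 0 ≤ t ∧ B ≤ x + c * t := fun t => by
    rw [hs, max_le_iff, div_le_iff₀ hc]
    constructor <;> rintro ⟨h1, h2⟩ <;> exact ⟨h1, by linarith⟩
  have h1 : (Set.Ioi 0 ∩ {t | B ≤ x + c * t} : Set ℝ) =ᵐ[volume] Set.Ioi s := by
    have e : (Set.Ici 0 ∩ {t | B ≤ x + c * t} : Set ℝ) = Set.Ici s := by
      ext t
      exact (hle t).symm
    exact (Ioi_ae_eq_Ici.inter (Filter.EventuallyEq.refl _ _)).trans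
      (e ▸ Ioi_ae_eq_Ici.symm)
  have h2 : ∫⁻ t in Set.Ioi 0, ENNReal.ofReal
      (Real.exp (-μ * t) * (μ * (x + c * t - min (x + c * t) B))) =
      ∫⁻ t in Set.Ioi s, ENNReal.ofReal (Real.exp (-μ * t) * (μ * ((x - B) + c * t))) := by
    rw [← lintegral_indicator measurableSet_Ioi, ← lintegral_indicator measurableSet_Ioi]
    refine lintegral_congr fun t => ?_
    by_cases ht : s < t
    · rw [Set.indicator_of_mem (Set.mem_Ioi.2 ht),
        Set.indicator_of_mem (Set.mem_Ioi.2 (hs0.trans_lt ht)),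
        min_eq_right ((hle t).1 ht.le).2]
      congr 3
      ring
    · rw [Set.indicator_of_notMem (s := Set.Ioi s) (by simpa using ht)]
      by_cases ht0 : 0 < t
      · have h3 : x + c * t ≤ B := by
          have h4 : c * t ≤ c * s := mul_le_mul_of_nonneg_left (not_lt.1 ht) hc.le
          rcases max_choice 0 (B - x) with h5 | h5
          · rw [hcs, h5] at h4
            nlinarith [mul_pos hc ht0]
          · rw [hcs, h5] at h4
            linarith
        rw [Set.indicator_of_mem (Set.mem_Ioi.2 ht0), min_eq_left h3]
        simp
      · rw [Set.indicator_of_notMem (by simpa using ht0)]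
  have h3 : ∫⁻ t in Set.Ioi s, ENNReal.ofReal (c * Real.exp (-μ * t)) =
      ENNReal.ofReal (c / μ * Real.exp (-μ * s)) := by
    have hint := (integrableOn_exp_mul_Ioi (neg_lt_zero.2 hμ) s).const_mul c
    rw [← ofReal_integral_eq_lintegral_ofReal hint
      (Filter.Eventually.of_forall fun t => by positivity), integral_const_mul,
      integral_exp_mul_Ioi (neg_lt_zero.2 hμ)]
    congr 1
    field_simp
  have h4 : x - B + c * s = max (x - B) 0 := by
    rw [hcs, ← max_add_add_left, add_zero]
    congr 1
    ring
  rw [setLIntegral_congr h1, h2, h3, lintegral_exp_Ioi hμ hc (by rw [h4]; exact le_max_right _ _),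
    h4, mul_add]
  have h5 : Real.exp (-μ * s) * max (x - B) 0 = max (x - B) 0 := by
    rcases le_total (x - B) 0 with h | h
    · rw [max_eq_right h, mul_zero]
    · have : s = 0 := by
        rw [hs]
        exact max_eq_left (div_nonpos_of_nonpos_of_nonneg (by linarith) hc.le)
      simp [this]
  rw [h5, ENNReal.ofReal_add (le_max_right _ _) (by positivity), mul_comm (c / μ)]
  congr 1
  rcases le_total (x - B) 0 with h | h
  · rw [max_eq_right h, ENNReal.ofReal_zero, ENNReal.ofReal_of_nonpos h]
  · rw [max_eq_left h]

/-- The rate at which phase `i` is left plus the discount rate. -/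
def killRate (M : RiskModel n) (i : Fin n) : ℝ := M.rate i + M.δ

lemma killRate_pos (M : RiskModel n) (i : Fin n) : 0 < M.killRate i :=
  add_pos (M.rate_pos i) M.δ_pos

/-- By Tonelli, the premium paid at time t is weighted by the probability e^{-λ_i t} that the
sojourn still lasts, which turns the discount rate δ into μ_i. -/
lemma lintegral_sojournReward (M : RiskModel n) (i : Fin n) (B x : ℝ) :
    ∫⁻ h, M.sojournReward B x h ∂expMeasure (M.rate i) =
      ∫⁻ t in Set.Ioi 0, ENNReal.ofReal (Real.exp (-M.killRate i * t) *
        (M.killRate i * (x + M.c * t - min (x + M.c * t) B))) := by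
  have := isProbabilityMeasure_expMeasure (M.rate_pos i)
  rw [← lintegral_excess (M.killRate_pos i) M.c_pos]
  simp only [sojournReward]
  rw [lintegral_add_left measurable_const, lintegral_const, measure_univ, mul_one]
  congr 1
  have hset : MeasurableSet {q : ℝ × ℝ | 0 ≤ q.2 ∧ q.2 < q.1 ∧ B ≤ x + M.c * q.2} :=
    (measurableSet_le (f := fun _ : ℝ × ℝ => (0 : ℝ)) (g := fun q => q.2)
    (by fun_prop) (by fun_prop)).inter
    ((measurableSet_lt (f := fun q : ℝ × ℝ => q.2) (g := fun q => q.1)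
      (by fun_prop) (by fun_prop)).inter
      (measurableSet_le (f := fun _ : ℝ × ℝ => B) (g := fun q => x + M.c * q.2)
        (by fun_prop) (by fun_prop)))
  have hm : Measurable (Set.indicator {q : ℝ × ℝ | 0 ≤ q.2 ∧ q.2 < q.1 ∧ B ≤ x + M.c * q.2}
      (fun q => ENNReal.ofReal (Real.exp (-M.δ * q.2)))) :=
    Measurable.indicator (f := fun q : ℝ × ℝ => ENNReal.ofReal (Real.exp (-M.δ * q.2)))
      (by fun_prop) hset
  have h1 : ∀ h, ∫⁻ t in {t : ℝ | 0 ≤ t ∧ t < h ∧ B ≤ x + M.c * t},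
      ENNReal.ofReal (Real.exp (-M.δ * t)) =
      ∫⁻ t, Set.indicator {q : ℝ × ℝ | 0 ≤ q.2 ∧ q.2 < q.1 ∧ B ≤ x + M.c * q.2}
        (fun q => ENNReal.ofReal (Real.exp (-M.δ * q.2))) (h, t) := fun h => by
    rw [← lintegral_indicator (M.measurableSet_sojourn _ _ _)]
    rfl
  have hS : MeasurableSet (Set.Ici 0 ∩ {t | B ≤ x + M.c * t} : Set ℝ) :=
    measurableSet_Ici.inter (measurableSet_le measurable_const (by fun_prop))
  have hS' : (Set.Ioi 0 ∩ {t | B ≤ x + M.c * t} : Set ℝ) =ᵐ[volume]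
      (Set.Ici 0 ∩ {t | B ≤ x + M.c * t} : Set ℝ) :=
    Ioi_ae_eq_Ici.inter (Filter.EventuallyEq.refl _ _)
  simp_rw [h1]
  rw [lintegral_const_mul _ (Measurable.lintegral_prod_right' hm),
    lintegral_lintegral_swap (f := fun h t =>
      Set.indicator {q : ℝ × ℝ | 0 ≤ q.2 ∧ q.2 < q.1 ∧ B ≤ x + M.c * q.2}
        (fun q => ENNReal.ofReal (Real.exp (-M.δ * q.2))) (h, t)) hm.aemeasurable,
    setLIntegral_congr hS', ← lintegral_indicator hS, ← lintegral_const_mul _ (Measurable.lintegral_prod_left' hm)]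
  refine lintegral_congr fun t => ?_
  by_cases ht : t ∈ (Set.Ici 0 ∩ {t | B ≤ x + M.c * t} : Set ℝ)
  · have h2 : ∀ h, Set.indicator {q : ℝ × ℝ | 0 ≤ q.2 ∧ q.2 < q.1 ∧ B ≤ x + M.c * q.2}
        (fun q => ENNReal.ofReal (Real.exp (-M.δ * q.2))) (h, t) =
        Set.indicator (Set.Ioi t) (fun _ => ENNReal.ofReal (Real.exp (-M.δ * t))) h := fun h => by
      by_cases hh : t < h
      · have hq : (h, t) ∈ {q : ℝ × ℝ | 0 ≤ q.2 ∧ q.2 < q.1 ∧ B ≤ x + M.c * q.2} :=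
          ⟨ht.1, hh, ht.2⟩
        rw [Set.indicator_of_mem hq,
          Set.indicator_of_mem (Set.mem_Ioi.2 hh)]
      · rw [Set.indicator_of_notMem (fun hq => hh hq.2.1),
          Set.indicator_of_notMem (by simpa using hh)]
    simp_rw [h2]
    rw [lintegral_indicator measurableSet_Ioi, setLIntegral_const, expMeasure_Ioi (M.rate_pos i) ht.1,
      Set.indicator_of_mem ht, ← ENNReal.ofReal_mul (Real.exp_nonneg _),
      ← ENNReal.ofReal_mul M.c_pos.le, ← Real.exp_add]
    congr 3
    rw [killRate]
    ring
  · have h2 : ∀ h, Set.indicator {q : ℝ × ℝ | 0 ≤ q.2 ∧ q.2 < q.1 ∧ B ≤ x + M.c * q.2}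
        (fun q => ENNReal.ofReal (Real.exp (-M.δ * q.2))) (h, t) = 0 := fun h =>
      Set.indicator_of_notMem (fun hq => ht ⟨hq.1, hq.2.2⟩) _
    simp_rw [h2]
    rw [Set.indicator_of_notMem ht]
    simp

/-- The expectation of `F` after a claim that occurs with surplus `y`. -/
def claimValue (M : RiskModel n) (F : Fin n → ℝ → ℝ≥0∞) (y : ℝ) : ℝ≥0∞ :=
  ∑ k, ENNReal.ofReal (M.π k) * ∫⁻ u, F k (y - u) ∂expMeasure M.β

/-- The inflow from `F` due to the jumps out of phase `i`. -/
def jumpValue (M : RiskModel n) (F : Fin n → ℝ → ℝ≥0∞) (i : Fin n) (y : ℝ) : ℝ≥0∞ :=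
  ∑ j ∈ Finset.univ.erase i, ENNReal.ofReal (M.Λ i.castSucc j.castSucc) * F j y +
    ENNReal.ofReal (M.Λ i.castSucc (Fin.last n)) * M.claimValue F y

lemma measurable_claimValue (M : RiskModel n) {F : Fin n → ℝ → ℝ≥0∞} (hF : ∀ i, Measurable (F i)) :
    Measurable (M.claimValue F) := by
  have := isProbabilityMeasure_expMeasure M.β_pos
  refine Finset.measurable_fun_sum _ fun k _ => Measurable.const_mul ?_ _
  exact Measurable.lintegral_prod_right' (f := fun p : ℝ × ℝ => F k (p.1 - p.2))
    ((hF k).comp (by fun_prop))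

lemma measurable_jumpValue (M : RiskModel n) {F : Fin n → ℝ → ℝ≥0∞} (hF : ∀ i, Measurable (F i))
    (i : Fin n) : Measurable (M.jumpValue F i) :=
  (Finset.measurable_fun_sum _ fun j _ => (hF j).const_mul _).add
    ((M.measurable_claimValue hF).const_mul _)

/-- The factor λ_i of the exponential density turns the jump probabilities back into intensities. -/
lemma lintegral_nextValue (M : RiskModel n) {F : Fin n → ℝ → ℝ≥0∞} (hF : ∀ i, Measurable (F i))
    (i : Fin n) (y : ℝ) :
    ENNReal.ofReal (M.rate i) *
      ∫⁻ p : Fin (n + 1) × Fin n × ℝ,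
        F (Fin.lastCases (motive := fun _ => Fin n) p.2.1 (fun j => j) p.1)
          (y - if p.1 = Fin.last n then p.2.2 else 0)
          ∂((M.jumpLaw i).prod (M.restartLaw.prod (expMeasure M.β))) = M.jumpValue F i y := by
  have := isProbabilityMeasure_expMeasure M.β_pos
  have hm : Measurable fun p : Fin (n + 1) × Fin n × ℝ =>
        F (Fin.lastCases (motive := fun _ => Fin n) p.2.1 (fun j => j) p.1)
          (y - if p.1 = Fin.last n then p.2.2 else 0) := by
    refine measurable_from_prod_countable_right fun j => measurable_from_prod_countable_right
      fun k => ?_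
    refine (hF (Fin.lastCases (motive := fun _ => Fin n) k (fun j => j) j)).comp
      (f := fun u : ℝ => y - if j = Fin.last n then u else 0) ?_
    split_ifs <;> fun_prop
  have h1 : ∀ j : Fin n, ∫⁻ q : Fin n × ℝ,
        F (Fin.lastCases (motive := fun _ => Fin n) q.1 (fun j => j) j.castSucc)
          (y - if j.castSucc = Fin.last n then q.2 else 0)
          ∂(M.restartLaw.prod (expMeasure M.β)) = F j y := fun j => by
    simp [(Fin.castSucc_lt_last j).ne]
  have h2 : ∫⁻ q : Fin n × ℝ,
        F (Fin.lastCases (motive := fun _ => Fin n) q.1 (fun j => j) (Fin.last n))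
          (y - if Fin.last n = Fin.last n then q.2 else 0)
          ∂(M.restartLaw.prod (expMeasure M.β)) = M.claimValue F y := by
    have hm2 : Measurable fun q : Fin n × ℝ => F q.1 (y - q.2) :=
      measurable_from_prod_countable_right fun k => (hF k).comp (by fun_prop)
    simp only [Fin.lastCases_last, if_true]
    rw [lintegral_prod _ hm2.aemeasurable, restartLaw, lintegral_finsetSum_measure]
    simp [claimValue, lintegral_smul_measure]
  have h3 : ∀ j, ENNReal.ofReal (M.rate i) * ENNReal.ofReal (M.Λ i.castSucc j / M.rate i) =
      ENNReal.ofReal (M.Λ i.castSucc j) := fun j => by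
    rw [← ENNReal.ofReal_mul (M.rate_pos i).le, mul_div_cancel₀ _ (M.rate_pos i).ne']
  have h4 : Finset.univ.erase i.castSucc =
      insert (Fin.last n) ((Finset.univ.erase i).map Fin.castSuccEmb) := by
    ext j
    refine Fin.lastCases ?_ (fun j => ?_) j
    · simp [(Fin.castSucc_lt_last i).ne']
    · simp [(Fin.castSucc_lt_last j).ne]
  have h5 : Fin.last n ∉ (Finset.univ.erase i).map Fin.castSuccEmb := by
    simp [(Fin.castSucc_lt_last _).ne]
  rw [lintegral_prod _ hm.aemeasurable, jumpLaw, lintegral_finsetSum_measure, Finset.mul_sum]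
  simp_rw [lintegral_smul_measure, lintegral_dirac, smul_eq_mul, ← mul_assoc, h3]
  rw [h4, Finset.sum_insert h5, h2, Finset.sum_map, add_comm, jumpValue]
  congr 1
  exact Finset.sum_congr rfl fun j _ => congrArg _ (h1 j)

/-- The one-sojourn operator as an integral over time. -/
lemma stepValue_eq_lintegral (M : RiskModel n) (b : Fin n → ℝ) {F : Fin n → ℝ → ℝ≥0∞}
    (hF : ∀ i, Measurable (F i)) (i : Fin n) (x : ℝ) :
    M.stepValue b F i x = ∫⁻ t in Set.Ioi 0, (ENNReal.ofReal (Real.exp (-M.killRate i * t) *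
        (M.killRate i * (x + M.c * t - min (x + M.c * t) (b i)))) +
      ENNReal.ofReal (Real.exp (-M.killRate i * t)) *
        M.jumpValue F i (min (x + M.c * t) (b i))) := by
  have := fun i => isProbabilityMeasure_expMeasure (M.rate_pos i)
  have := isProbabilityMeasure_expMeasure M.β_pos
  have hmp : MeasurePreserving (fun a : Noise n => (a.1 i, a.2.1 i, a.2.2)) M.stepLaw
      ((expMeasure (M.rate i)).prod ((M.jumpLaw i).prod (M.restartLaw.prod (expMeasure M.β)))) :=
    (measurePreserving_eval _ i).prod ((measurePreserving_eval _ i).prod (MeasurePreserving.id _))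
  have hmp1 : MeasurePreserving (fun a : Noise n => a.1 i) M.stepLaw (expMeasure (M.rate i)) :=
    (measurePreserving_eval _ i).comp measurePreserving_fst
  rw [stepValue, lintegral_add_left (M.measurable_sojournReward_noise (b i) x i),
    lintegral_add_left (by fun_prop), ← M.lintegral_sojournReward i (b i) x,
    hmp1.lintegral_comp (f := fun h => M.sojournReward (b i) x h)
      ((M.measurable_sojournReward (b i)).comp measurable_prodMk_left)]
  congr 1
  let g : ℝ × Fin (n + 1) × Fin n × ℝ → ℝ≥0∞ := fun p => ENNReal.ofReal (Real.exp (-M.δ * p.1)) *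
    F (Fin.lastCases (motive := fun _ => Fin n) p.2.2.1 (fun j => j) p.2.1)
      (min (x + M.c * p.1) (b i) - if p.2.1 = Fin.last n then p.2.2.2 else 0)
  have hm0 : ∀ j k, Measurable fun q : ℝ × ℝ =>
      F (Fin.lastCases (motive := fun _ => Fin n) k (fun j => j) j)
        (min (x + M.c * q.1) (b i) - if j = Fin.last n then q.2 else 0) := fun j k => by
    refine (hF _).comp ?_
    split_ifs <;> fun_prop
  have hg : Measurable g := by
    refine Measurable.mul (by fun_prop) ?_
    have e : Measurable fun p : Fin (n + 1) × Fin n × (ℝ × ℝ) =>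
        F (Fin.lastCases (motive := fun _ => Fin n) p.2.1 (fun j => j) p.1)
        (min (x + M.c * p.2.2.1) (b i) - if p.1 = Fin.last n then p.2.2.2 else 0) :=
      measurable_from_prod_countable_right fun j =>
        measurable_from_prod_countable_right fun k => hm0 j k
    exact e.comp (f := fun p : ℝ × Fin (n + 1) × Fin n × ℝ => (p.2.1, p.2.2.1, p.1, p.2.2.2))
      (by fun_prop)
  have h1 : ∫⁻ a, ENNReal.ofReal (Real.exp (-M.δ * a.1 i)) *
      F (nextPhase i a) (M.nextSurplus b i x a) ∂M.stepLaw = ∫⁻ p, g p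
      ∂((expMeasure (M.rate i)).prod ((M.jumpLaw i).prod (M.restartLaw.prod (expMeasure M.β)))) :=
    hmp.lintegral_comp hg
  have hgh : ∀ h, Measurable fun p => g (h, p) := fun h => hg.comp measurable_prodMk_left
  rw [h1, lintegral_prod _ hg.aemeasurable,
    lintegral_expMeasure (M.rate i) (Measurable.lintegral_prod_right' hg)]
  refine setLIntegral_congr_fun measurableSet_Ioi fun t _ => ?_
  have h2 : ∫⁻ p, g (t, p) ∂((M.jumpLaw i).prod (M.restartLaw.prod (expMeasure M.β))) =
      ENNReal.ofReal (Real.exp (-M.δ * t)) * ∫⁻ p : Fin (n + 1) × Fin n × ℝ,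
        F (Fin.lastCases (motive := fun _ => Fin n) p.2.1 (fun j => j) p.1)
          (min (x + M.c * t) (b i) - if p.1 = Fin.last n then p.2.2 else 0)
          ∂((M.jumpLaw i).prod (M.restartLaw.prod (expMeasure M.β))) := by
    simp only [g]
    rw [lintegral_const_mul' _ _ ENNReal.ofReal_ne_top]
  rw [h2, ← M.lintegral_nextValue hF i, ENNReal.ofReal_mul (M.rate_pos i).le]
  have h3 : ENNReal.ofReal (Real.exp (-M.killRate i * t)) =
      ENNReal.ofReal (Real.exp (-M.rate i * t)) * ENNReal.ofReal (Real.exp (-M.δ * t)) := by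
    rw [← ENNReal.ofReal_mul (Real.exp_nonneg _), ← Real.exp_add, killRate]
    congr 2
    ring
  rw [h3]
  ring

/-! ### The value as a real function -/

lemma value_ne_top (M : RiskModel n) {b : Fin n → ℝ} (hb : ∀ i, 0 ≤ b i) (i : Fin n) (x : ℝ) :
    M.value b i x ≠ ∞ := by
  rcases lt_or_ge x 0 with hx | hx
  · simp [M.value_of_neg hb i hx]
  · exact ne_top_of_le_ne_top ENNReal.ofReal_ne_top (M.value_le hb i hx)

lemma claimValue_value_ne_top (M : RiskModel n) {b : Fin n → ℝ} (hb : ∀ i, 0 ≤ b i) (y : ℝ) :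
    M.claimValue (M.value b) y ≠ ∞ := by
  have := isProbabilityMeasure_expMeasure M.β_pos
  refine ENNReal.sum_ne_top.2 fun k _ => ENNReal.mul_ne_top ENNReal.ofReal_ne_top ?_
  have h : ∀ᵐ u ∂expMeasure M.β, M.value b k (y - u) ≤ ENNReal.ofReal (y + M.c / M.δ) := by
    filter_upwards [ae_expMeasure_pos M.β_pos] with u hu
    rcases lt_or_ge (y - u) 0 with hx | hx
    · simp [M.value_of_neg hb k hx]
    · exact (M.value_le hb k hx).trans (ENNReal.ofReal_le_ofReal (by linarith))
  exact ne_top_of_le_ne_top (ENNReal.ofReal_ne_top (r := y + M.c / M.δ))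
    ((lintegral_mono_ae h).trans (by simp))

lemma jumpValue_value_ne_top (M : RiskModel n) {b : Fin n → ℝ} (hb : ∀ i, 0 ≤ b i) (i : Fin n)
    (y : ℝ) : M.jumpValue (M.value b) i y ≠ ∞ :=
  ENNReal.add_ne_top.2 ⟨ENNReal.sum_ne_top.2 fun j _ =>
    ENNReal.mul_ne_top ENNReal.ofReal_ne_top (M.value_ne_top hb j y),
    ENNReal.mul_ne_top ENNReal.ofReal_ne_top (M.claimValue_value_ne_top hb y)⟩

/-- The value as a real number. -/
def realValue (M : RiskModel n) (b : Fin n → ℝ) (i : Fin n) (x : ℝ) : ℝ := (M.value b i x).toReal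

/-- The value after a claim as a real number. -/
def realClaimValue (M : RiskModel n) (b : Fin n → ℝ) (y : ℝ) : ℝ :=
  (M.claimValue (M.value b) y).toReal

/-- The net rate at which the value would grow in phase `i` if the surplus were kept at `y` without
collecting premiums, up to a constant: this function governs the choice of the barrier. -/
def gain (M : RiskModel n) (b : Fin n → ℝ) (i : Fin n) (y : ℝ) : ℝ :=
  (M.jumpValue (M.value b) i y).toReal - M.killRate i * y

lemma gain_eq (M : RiskModel n) {b : Fin n → ℝ} (hb : ∀ i, 0 ≤ b i) (i : Fin n) (y : ℝ) :
    M.gain b i y = ∑ j ∈ Finset.univ.erase i, M.Λ i.castSucc j.castSucc * M.realValue b j y +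
      M.Λ i.castSucc (Fin.last n) * M.realClaimValue b y - M.killRate i * y := by
  have h1 : ∀ j ∈ Finset.univ.erase i,
      ENNReal.ofReal (M.Λ i.castSucc j.castSucc) * M.value b j y ≠ ∞ := fun j _ =>
    ENNReal.mul_ne_top ENNReal.ofReal_ne_top (M.value_ne_top hb j y)
  rw [gain, jumpValue, ENNReal.toReal_add (ENNReal.sum_ne_top.2 h1)
    (ENNReal.mul_ne_top ENNReal.ofReal_ne_top (M.claimValue_value_ne_top hb y)),
    ENNReal.toReal_sum h1, ENNReal.toReal_mul,
    ENNReal.toReal_ofReal (M.Λ_nonneg _ _ (Fin.castSucc_lt_last i).ne)]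
  congr 2
  refine Finset.sum_congr rfl fun j hj => ?_
  rw [ENNReal.toReal_mul, ENNReal.toReal_ofReal (M.Λ_nonneg _ _ fun h =>
    Finset.ne_of_mem_erase hj (Fin.castSucc_injective n h).symm)]
  rfl

lemma measurable_realValue (M : RiskModel n) {b : Fin n → ℝ} (hb : ∀ i, 0 ≤ b i) (i : Fin n) :
    Measurable (M.realValue b i) :=
  (M.measurable_value hb i).ennreal_toReal

lemma measurable_gain (M : RiskModel n) {b : Fin n → ℝ} (hb : ∀ i, 0 ≤ b i) (i : Fin n) :
    Measurable (M.gain b i) :=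
  (M.measurable_jumpValue (M.measurable_value hb) i).ennreal_toReal.sub (by fun_prop)

/-- The sum is μ_i (z - min(z, B)), from dividends, plus a nonnegative inflow. Hence passing through
`ENNReal.ofReal` loses nothing. -/
lemma killRate_mul_add_gain_nonneg (M : RiskModel n) (b : Fin n → ℝ) (i : Fin n) (B z : ℝ) :
    0 ≤ M.killRate i * z + M.gain b i (min z B) := by
  have h := mul_nonneg (M.killRate_pos i).le (sub_nonneg.2 (min_le_left z B))
  have h2 : 0 ≤ (M.jumpValue (M.value b) i (min z B)).toReal := ENNReal.toReal_nonneg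
  rw [gain]
  linarith

/-- The term -μ_i min(z, B) from the dividends is absorbed into `gain`, so that the barriers of the
first sojourn can be compared through `gain` alone. -/
lemma stepValue_value (M : RiskModel n) {b : Fin n → ℝ} (hb : ∀ i, 0 ≤ b i) (b' : Fin n → ℝ)
    (i : Fin n) (x : ℝ) :
    M.stepValue b' (M.value b) i x = ∫⁻ t in Set.Ioi 0, ENNReal.ofReal
      (Real.exp (-M.killRate i * t) *
        (M.killRate i * (x + M.c * t) + M.gain b i (min (x + M.c * t) (b' i)))) := by
  rw [M.stepValue_eq_lintegral b' (M.measurable_value hb)]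
  refine lintegral_congr fun t => ?_
  set z := x + M.c * t
  have h := mul_nonneg (M.killRate_pos i).le (sub_nonneg.2 (min_le_left z (b' i)))
  rw [← ENNReal.ofReal_toReal (M.jumpValue_value_ne_top hb i (min z (b' i))),
    ← ENNReal.ofReal_mul (Real.exp_nonneg _), ← ENNReal.ofReal_add
      (mul_nonneg (Real.exp_nonneg _) h) (mul_nonneg (Real.exp_nonneg _) ENNReal.toReal_nonneg),
    gain]
  congr 1
  ring

lemma measurable_gain_integrand (M : RiskModel n) {b : Fin n → ℝ} (hb : ∀ i, 0 ≤ b i) (i : Fin n)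
    (B x : ℝ) : Measurable fun t : ℝ => Real.exp (-M.killRate i * t) *
        (M.killRate i * (x + M.c * t) + M.gain b i (min (x + M.c * t) B)) := by
  have h : Measurable fun t : ℝ => M.gain b i (min (x + M.c * t) B) :=
    (M.measurable_gain hb i).comp (by fun_prop)
  fun_prop

/-- Optimal barriers cannot be improved in one phase: a barrier `B` with a larger gain than `b i`
cannot dominate it along the way. -/
lemma not_gain_lt_of_isOptimal (M : RiskModel n) {b : Fin n → ℝ} (hb : M.IsOptimal b) {i : Fin n}
    (hi : 0 < b i) {B : ℝ} (hB : 0 ≤ B)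
    (h : ∀ z, 0 ≤ z → M.gain b i (min z (b i)) ≤ M.gain b i (min z B)) :
    ¬ M.gain b i (b i) < M.gain b i B := by
  intro hlt
  obtain ⟨hb0, hopt⟩ := hb
  set b' := Function.update b i B with hb'
  have hb'i : b' i = B := Function.update_self i B b
  have hb'0 : ∀ j, 0 ≤ b' j := fun j => by
    rcases eq_or_ne j i with rfl | hj
    · rwa [hb'i]
    · rw [hb', Function.update_of_ne hj]
      exact hb0 j
  have hμ := M.killRate_pos i
  have hpoint : ∀ x, 0 ≤ x → ∀ t ∈ Set.Ioi (0 : ℝ), ENNReal.ofReal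
      (Real.exp (-M.killRate i * t) *
        (M.killRate i * (x + M.c * t) + M.gain b i (min (x + M.c * t) (b i)))) ≤ ENNReal.ofReal
      (Real.exp (-M.killRate i * t) *
        (M.killRate i * (x + M.c * t) + M.gain b i (min (x + M.c * t) B))) := by
    intro x hx t ht
    have hz : 0 ≤ x + M.c * t := add_nonneg hx (mul_nonneg M.c_pos.le (le_of_lt ht))
    have := h _ hz
    gcongr
  -- Using `b'` for one sojourn and `b` afterwards is no worse than `b`; iteration carries this over
  -- to using `b'` forever.
  have hstep : ∀ j x, 0 ≤ x → M.value b j x ≤ M.stepValue b' (M.value b) j x := by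
    intro j x hx
    rw [M.value_eq_stepValue hb0 j hx, M.stepValue_value hb0, M.stepValue_value hb0]
    rcases eq_or_ne j i with rfl | hj
    · rw [hb'i]
      exact setLIntegral_mono' measurableSet_Ioi (hpoint x hx)
    · rw [hb', Function.update_of_ne hj]
  have hle : ∀ j x, M.value b j x ≤ M.value b' j x :=
    M.le_value_of_le_stepValue hb'0 (fun j x hx => M.value_le hb0 j hx)
      (fun j x hx => M.value_of_neg hb0 j hx) hstep
  have hstrict : M.stepValue b (M.value b) i 0 < M.stepValue b' (M.value b) i 0 := by
    have hfin : M.stepValue b (M.value b) i 0 ≠ ∞ := by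
      rw [← M.value_eq_stepValue hb0 i le_rfl]
      exact M.value_ne_top hb0 i 0
    rw [M.stepValue_value hb0] at hfin ⊢
    rw [M.stepValue_value hb0, hb'i]
    -- From time `T` on, the surplus started at 0 rests at its barrier under either choice, so the
    -- strict inequality at the barriers holds on a set of positive measure.
    set T := max (b i) B / M.c
    have hT : 0 ≤ T := div_nonneg (le_max_of_le_right hB) M.c_pos.le
    refine lintegral_strict_mono_of_ae_le_of_ae_lt_on
      (M.measurable_gain_integrand hb0 i B 0).ennreal_ofReal.aemeasurable hfin
      ((ae_restrict_iff' measurableSet_Ioi).2 (Filter.Eventually.of_forall (hpoint 0 le_rfl)))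
      (s := Set.Ioi T) ?_ (Filter.Eventually.of_forall fun t ht => ?_)
    · rw [Measure.restrict_apply measurableSet_Ioi, Set.inter_eq_left.2 (Set.Ioi_subset_Ioi hT)]
      simp
    · have ht' : max (b i) B < 0 + M.c * t := by
        have := (div_lt_iff₀ M.c_pos).1 (Set.mem_Ioi.1 ht)
        linarith
      have h0 := M.killRate_mul_add_gain_nonneg b i (b i) (0 + M.c * t)
      rw [min_eq_right ((le_max_left _ _).trans ht'.le)] at h0 ⊢
      rw [min_eq_right ((le_max_right _ _).trans ht'.le)]
      have he := Real.exp_pos (-M.killRate i * t)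
      rw [ENNReal.ofReal_lt_ofReal_iff (mul_pos he (by linarith))]
      gcongr
  refine absurd (hopt b' hb'0 i 0 le_rfl hi) (not_le.2 ?_)
  calc M.value b i 0 = M.stepValue b (M.value b) i 0 := M.value_eq_stepValue hb0 i le_rfl
    _ < M.stepValue b' (M.value b) i 0 := hstrict
    _ ≤ M.stepValue b' (M.value b') i 0 := M.stepValue_mono b' hle i 0
    _ = M.value b' i 0 := (M.value_eq_stepValue hb'0 i le_rfl).symm

/-! ### Regularity of the value -/

lemma integrableOn_gain_integrand (M : RiskModel n) {b : Fin n → ℝ} (hb : ∀ i, 0 ≤ b i) (i : Fin n)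
    {x : ℝ} (hx : 0 ≤ x) : IntegrableOn (fun t : ℝ => Real.exp (-M.killRate i * t) *
        (M.killRate i * (x + M.c * t) + M.gain b i (min (x + M.c * t) (b i)))) (Set.Ioi 0) := by
  refine ⟨(M.measurable_gain_integrand hb i (b i) x).aestronglyMeasurable, ?_⟩
  rw [hasFiniteIntegral_iff_ofReal (Filter.Eventually.of_forall fun t =>
    mul_nonneg (Real.exp_nonneg _) (M.killRate_mul_add_gain_nonneg b i _ _)),
    ← M.stepValue_value hb b, ← M.value_eq_stepValue hb i hx]
  exact (M.value_ne_top hb i x).lt_top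

lemma realValue_eq_integral (M : RiskModel n) {b : Fin n → ℝ} (hb : ∀ i, 0 ≤ b i) (i : Fin n)
    {x : ℝ} (hx : 0 ≤ x) : M.realValue b i x = ∫ t in Set.Ioi 0, Real.exp (-M.killRate i * t) *
        (M.killRate i * (x + M.c * t) + M.gain b i (min (x + M.c * t) (b i))) := by
  rw [realValue, M.value_eq_stepValue hb i hx, M.stepValue_value hb b,
    integral_eq_lintegral_of_nonneg_ae (Filter.Eventually.of_forall fun t =>
      mul_nonneg (Real.exp_nonneg _) (M.killRate_mul_add_gain_nonneg b i _ _))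
      (M.measurable_gain_integrand hb i (b i) x).aestronglyMeasurable]

/-- The excess over the barrier is paid at once, after which both surplus paths agree. -/
lemma realValue_of_barrier_le (M : RiskModel n) {b : Fin n → ℝ} (hb : ∀ i, 0 ≤ b i) (i : Fin n)
    {x : ℝ} (hx : b i ≤ x) : M.realValue b i x = M.realValue b i (b i) + (x - b i) := by
  have hμ := M.killRate_pos i
  have hx0 := (hb i).trans hx
  have h1 := M.integrableOn_gain_integrand hb i hx0
  have h2 := M.integrableOn_gain_integrand hb i (hb i)
  rw [← sub_eq_iff_eq_add', M.realValue_eq_integral hb i hx0, M.realValue_eq_integral hb i (hb i),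
    ← integral_sub h1 h2]
  have h3 : ∀ t ∈ Set.Ioi (0 : ℝ), Real.exp (-M.killRate i * t) *
        (M.killRate i * (x + M.c * t) + M.gain b i (min (x + M.c * t) (b i))) -
        Real.exp (-M.killRate i * t) *
        (M.killRate i * (b i + M.c * t) + M.gain b i (min (b i + M.c * t) (b i))) =
        Real.exp (-M.killRate i * t) * (M.killRate i * (x - b i)) := by
    intro t ht
    have hct : 0 ≤ M.c * t := mul_nonneg M.c_pos.le (le_of_lt ht)
    rw [min_eq_right (by linarith), min_eq_right (by linarith)]
    ring
  rw [setIntegral_congr_fun measurableSet_Ioi h3, integral_mul_const,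
    integral_exp_mul_Ioi (neg_lt_zero.2 hμ)]
  simp only [mul_zero, Real.exp_zero]
  field_simp

/-- The integrand of the value in the variable of the surplus. -/
def surplusIntegrand (M : RiskModel n) (b : Fin n → ℝ) (i : Fin n) (z : ℝ) : ℝ :=
  Real.exp (-(M.killRate i / M.c) * z) * (M.killRate i * z + M.gain b i (min z (b i)))

lemma exp_mul_surplusIntegrand (M : RiskModel n) (b : Fin n → ℝ) (i : Fin n) (x t : ℝ) :
    Real.exp (M.killRate i / M.c * x) * M.surplusIntegrand b i (x + M.c * t) =
      Real.exp (-M.killRate i * t) *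
        (M.killRate i * (x + M.c * t) + M.gain b i (min (x + M.c * t) (b i))) := by
  have hc := M.c_pos.ne'
  rw [surplusIntegrand, ← mul_assoc, ← Real.exp_add]
  congr 2
  field_simp
  ring

lemma measurable_surplusIntegrand (M : RiskModel n) {b : Fin n → ℝ} (hb : ∀ i, 0 ≤ b i)
    (i : Fin n) : Measurable (M.surplusIntegrand b i) := by
  have h : Measurable fun t : ℝ => M.gain b i (min t (b i)) :=
    (M.measurable_gain hb i).comp (by fun_prop)
  unfold surplusIntegrand
  fun_prop

lemma integrableOn_surplusIntegrand (M : RiskModel n) {b : Fin n → ℝ} (hb : ∀ i, 0 ≤ b i)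
    (i : Fin n) : IntegrableOn (M.surplusIntegrand b i) (Set.Ioi 0) := by
  have h := M.integrableOn_gain_integrand hb i le_rfl
  simp_rw [← M.exp_mul_surplusIntegrand b i 0, mul_zero, Real.exp_zero, one_mul, zero_add] at h
  simpa using (integrableOn_Ioi_comp_mul_left_iff (M.surplusIntegrand b i) 0 M.c_pos).1 h

/-- Substituting the surplus for time leaves `x` only in a smooth factor and in a limit of
integration, which gives the regularity of the value. -/
lemma realValue_eq (M : RiskModel n) {b : Fin n → ℝ} (hb : ∀ i, 0 ≤ b i) (i : Fin n) {x : ℝ}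
    (hx : 0 ≤ x) : M.realValue b i x = Real.exp (M.killRate i / M.c * x) * (M.c⁻¹ *
      ((∫ z in Set.Ioi 0, M.surplusIntegrand b i z) - ∫ z in 0..x, M.surplusIntegrand b i z)) := by
  rw [M.realValue_eq_integral hb i hx]
  simp_rw [← M.exp_mul_surplusIntegrand b i x]
  rw [integral_const_mul,
    integral_comp_mul_left_Ioi (fun u => M.surplusIntegrand b i (x + u)) 0 M.c_pos, mul_zero,
    smul_eq_mul, ← intervalIntegral.integral_Ioi_sub_Ioi (M.integrableOn_surplusIntegrand hb i) hx,
    sub_sub_cancel, ← integral_indicator measurableSet_Ioi, ← integral_indicator measurableSet_Ioi,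
    ← integral_add_left_eq_self (fun z => (Set.Ioi x).indicator (M.surplusIntegrand b i) z) x]
  congr 3
  ext u
  simp [Set.indicator]

lemma continuousAt_realValue (M : RiskModel n) {b : Fin n → ℝ} (hb : ∀ i, 0 ≤ b i) (i : Fin n)
    {x : ℝ} (hx : 0 < x) : ContinuousAt (M.realValue b i) x := by
  -- Integrability is known only on the positive half-line; the indicator provides a primitive that
  -- is continuous everywhere.
  have h1 : ∀ y, 0 ≤ y → ∫ z in 0..y, M.surplusIntegrand b i z =
      ∫ z in 0..y, (Set.Ioi 0).indicator (M.surplusIntegrand b i) z := fun y hy => by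
    rw [intervalIntegral.integral_of_le hy, intervalIntegral.integral_of_le hy]
    exact setIntegral_congr_fun measurableSet_Ioc fun z hz => (Set.indicator_of_mem hz.1 _).symm
  have h2 : Continuous fun y => ∫ z in 0..y, (Set.Ioi 0).indicator (M.surplusIntegrand b i) z :=
    ((M.integrableOn_surplusIntegrand hb i).integrable_indicator
      measurableSet_Ioi).continuous_primitive 0
  have h3 : Continuous fun y => Real.exp (M.killRate i / M.c * y) * (M.c⁻¹ *
      ((∫ z in Set.Ioi 0, M.surplusIntegrand b i z) -
        ∫ z in 0..y, (Set.Ioi 0).indicator (M.surplusIntegrand b i) z)) := by fun_prop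
  refine h3.continuousAt.congr ?_
  filter_upwards [lt_mem_nhds hx] with y hy
  rw [M.realValue_eq hb i hy.le, h1 y hy.le]

/-- The value averaged over the phase after a claim. -/
def restartValue (M : RiskModel n) (b : Fin n → ℝ) (y : ℝ) : ℝ := ∑ k, M.π k * M.realValue b k y

lemma realValue_nonneg (M : RiskModel n) (b : Fin n → ℝ) (i : Fin n) (x : ℝ) :
    0 ≤ M.realValue b i x := ENNReal.toReal_nonneg

lemma realValue_le (M : RiskModel n) {b : Fin n → ℝ} (hb : ∀ i, 0 ≤ b i) (i : Fin n) {x : ℝ}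
    (hx : 0 ≤ x) : M.realValue b i x ≤ x + M.c / M.δ :=
  ENNReal.toReal_le_of_le_ofReal (add_nonneg hx (div_nonneg M.c_pos.le M.δ_pos.le))
    (M.value_le hb i hx)

lemma intervalIntegrable_realValue (M : RiskModel n) {b : Fin n → ℝ} (hb : ∀ i, 0 ≤ b i) (i : Fin n)
    {y : ℝ} (hy : 0 ≤ y) :
    IntervalIntegrable (fun s => Real.exp (M.β * s) * M.realValue b i s) volume 0 y := by
  have h : IntervalIntegrable (M.realValue b i) volume 0 y := by
    rw [intervalIntegrable_iff_integrableOn_Ioc_of_le hy]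
    refine Measure.integrableOn_of_bounded (M := y + M.c / M.δ) (by simp)
      (M.measurable_realValue hb i).aestronglyMeasurable
      ((ae_restrict_iff' measurableSet_Ioc).2 (Filter.Eventually.of_forall fun s hs => ?_))
    rw [Real.norm_of_nonneg (M.realValue_nonneg b i s)]
    exact (M.realValue_le hb i hs.1.le).trans (by linarith [hs.2])
  exact h.continuousOn_mul (by fun_prop)

/-- Ruin makes the value vanish at negative surplus, so only claims up to `y` count; then s = y - u
is the surplus after the claim. -/
lemma toReal_lintegral_claim (M : RiskModel n) {b : Fin n → ℝ} (hb : ∀ i, 0 ≤ b i) (k : Fin n)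
    {y : ℝ} (hy : 0 ≤ y) : (∫⁻ u, M.value b k (y - u) ∂expMeasure M.β).toReal =
      M.β * Real.exp (-M.β * y) * ∫ s in 0..y, Real.exp (M.β * s) * M.realValue b k s := by
  have hm : Measurable fun u => M.value b k (y - u) := (M.measurable_value hb k).comp (by fun_prop)
  have h1 : ∫⁻ u, M.value b k (y - u) ∂expMeasure M.β =
      ∫⁻ u in Set.Ioc 0 y, ENNReal.ofReal (M.β * Real.exp (-M.β * u) * M.realValue b k (y - u)) := by
    rw [lintegral_expMeasure M.β hm, ← lintegral_indicator measurableSet_Ioi,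
      ← lintegral_indicator measurableSet_Ioc]
    refine lintegral_congr fun u => ?_
    by_cases hu : 0 < u
    · rw [Set.indicator_of_mem (Set.mem_Ioi.2 hu)]
      by_cases huy : u ≤ y
      · rw [Set.indicator_of_mem (Set.mem_Ioc.2 ⟨hu, huy⟩), ENNReal.ofReal_mul
          (mul_nonneg M.β_pos.le (Real.exp_nonneg _)), realValue,
          ENNReal.ofReal_toReal (M.value_ne_top hb k _)]
      · rw [Set.indicator_of_notMem (fun h => huy h.2), M.value_of_neg hb k (by linarith), mul_zero]
    · rw [Set.indicator_of_notMem (s := Set.Ioi 0) (by simpa using hu),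
        Set.indicator_of_notMem (fun h => hu h.1)]
  have hm2 : Measurable fun u => M.β * Real.exp (-M.β * u) * M.realValue b k (y - u) :=
    Measurable.mul (by fun_prop) ((M.measurable_realValue hb k).comp (by fun_prop))
  rw [h1, ← integral_eq_lintegral_of_nonneg_ae (Filter.Eventually.of_forall fun u =>
      mul_nonneg (mul_nonneg M.β_pos.le (Real.exp_nonneg _)) (M.realValue_nonneg b k _))
      hm2.aestronglyMeasurable, ← intervalIntegral.integral_of_le hy,
    ← intervalIntegral.integral_const_mul]
  have h2 := intervalIntegral.integral_comp_sub_left (a := 0) (b := y) (fun s =>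
    M.β * Real.exp (-M.β * y) * (Real.exp (M.β * s) * M.realValue b k s)) y
  simp only [sub_self, sub_zero] at h2
  rw [← h2]
  refine intervalIntegral.integral_congr fun u _ => ?_
  rw [mul_assoc, mul_assoc, ← mul_assoc (Real.exp (-M.β * y)), ← Real.exp_add]
  congr 3
  ring

lemma realClaimValue_eq (M : RiskModel n) {b : Fin n → ℝ} (hb : ∀ i, 0 ≤ b i) {y : ℝ} (hy : 0 ≤ y) :
    M.realClaimValue b y =
      M.β * Real.exp (-M.β * y) * ∫ s in 0..y, Real.exp (M.β * s) * M.restartValue b s := by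
  have hne := M.claimValue_value_ne_top hb y
  rw [claimValue, ENNReal.sum_ne_top] at hne
  rw [realClaimValue, claimValue, ENNReal.toReal_sum hne]
  simp_rw [ENNReal.toReal_mul, M.toReal_lintegral_claim hb _ hy, restartValue, Finset.mul_sum]
  rw [intervalIntegral.integral_finsetSum, Finset.mul_sum]
  · refine Finset.sum_congr rfl fun k _ => ?_
    rw [ENNReal.toReal_ofReal (M.π_nonneg k), ← mul_assoc, mul_comm (M.π k), mul_assoc,
      ← intervalIntegral.integral_const_mul]
    simp_rw [mul_left_comm]
  · intro k _
    have := (M.intervalIntegrable_realValue hb k hy).const_mul (M.π k)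
    simp_rw [mul_left_comm (M.π k)] at this
    exact this

lemma continuousAt_restartValue (M : RiskModel n) {b : Fin n → ℝ} (hb : ∀ i, 0 ≤ b i) {y : ℝ}
    (hy : 0 < y) : ContinuousAt (M.restartValue b) y :=
  tendsto_finsetSum _ fun k _ => (M.continuousAt_realValue hb k hy).const_mul (M.π k)

/-- Exponential claims turn the convolution into e^{-βy} times a primitive, hence into a solution of
a first-order equation. -/
lemma hasDerivAt_realClaimValue (M : RiskModel n) {b : Fin n → ℝ} (hb : ∀ i, 0 ≤ b i) {y : ℝ}
    (hy : 0 < y) : HasDerivAt (M.realClaimValue b)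
      (M.β * (M.restartValue b y - M.realClaimValue b y)) y := by
  have hint : IntervalIntegrable (fun s => Real.exp (M.β * s) * M.restartValue b s) volume 0 y := by
    simp_rw [restartValue, Finset.mul_sum, mul_left_comm (Real.exp _)]
    have := IntervalIntegrable.sum Finset.univ fun k _ =>
      (M.intervalIntegrable_realValue hb k hy.le).const_mul (M.π k)
    simpa only [Finset.sum_fn] using this
  have hmeas : Measurable fun s => Real.exp (M.β * s) * M.restartValue b s :=
    Measurable.mul (by fun_prop) (Finset.measurable_fun_sum _ fun k _ =>
      (M.measurable_realValue hb k).const_mul _)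
  have hcont : ContinuousAt (fun s => Real.exp (M.β * s) * M.restartValue b s) y :=
    ContinuousAt.mul (by fun_prop) (M.continuousAt_restartValue hb hy)
  have h1 := intervalIntegral.integral_hasDerivAt_right hint
    hmeas.stronglyMeasurable.stronglyMeasurableAtFilter hcont
  have h2 : HasDerivAt (fun y : ℝ => -M.β * y) (-M.β) y := by
    simpa using (hasDerivAt_id y).const_mul (-M.β)
  refine (((h2.exp.const_mul M.β).mul h1).congr_deriv ?_).congr_of_eventuallyEq ?_
  · rw [M.realClaimValue_eq hb hy.le]
    have : Real.exp (-M.β * y) * Real.exp (M.β * y) = 1 := by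
      rw [← Real.exp_add]; simp
    linear_combination M.β * M.restartValue b y * this
  · filter_upwards [lt_mem_nhds hy] with u hu
    exact M.realClaimValue_eq hb hu.le

lemma continuousAt_gain (M : RiskModel n) {b : Fin n → ℝ} (hb : ∀ i, 0 ≤ b i) (i : Fin n) {y : ℝ}
    (hy : 0 < y) : ContinuousAt (M.gain b i) y := by
  rw [funext (M.gain_eq hb i)]
  refine ((tendsto_finsetSum _ fun j _ => (M.continuousAt_realValue hb j hy).const_mul _).add
    ((M.hasDerivAt_realClaimValue hb hy).continuousAt.const_mul _)).sub
    (ContinuousAt.const_mul continuousAt_id _)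

lemma hasDerivAt_realValue (M : RiskModel n) {b : Fin n → ℝ} (hb : ∀ i, 0 ≤ b i) {i : Fin n}
    (hi : 0 < b i) {x : ℝ} (hx : 0 < x) : HasDerivAt (M.realValue b i)
      ((M.killRate i * (M.realValue b i x - x) - M.gain b i (min x (b i))) / M.c) x := by
  have hc := M.c_pos.ne'
  have hcont : ContinuousAt (M.surplusIntegrand b i) x := by
    have h1 : ContinuousAt (fun z => M.gain b i (min z (b i))) x :=
      ContinuousAt.comp (f := fun z => min z (b i)) (M.continuousAt_gain hb i (lt_min hx hi))
        (by fun_prop)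
    unfold surplusIntegrand
    fun_prop
  have hint : IntervalIntegrable (M.surplusIntegrand b i) volume 0 x :=
    (intervalIntegrable_iff_integrableOn_Ioc_of_le hx.le).2
      ((M.integrableOn_surplusIntegrand hb i).mono_set Set.Ioc_subset_Ioi_self)
  have h1 := intervalIntegral.integral_hasDerivAt_right hint
    (M.measurable_surplusIntegrand hb i).stronglyMeasurable.stronglyMeasurableAtFilter hcont
  have h2 : HasDerivAt (fun y : ℝ => M.killRate i / M.c * y) (M.killRate i / M.c) x := by
    simpa using (hasDerivAt_id x).const_mul (M.killRate i / M.c)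
  refine ((h2.exp.mul ((h1.const_sub _).const_mul M.c⁻¹)).congr_deriv ?_).congr_of_eventuallyEq
    (f₁ := M.realValue b i) (f := fun x => Real.exp (M.killRate i / M.c * x) * (M.c⁻¹ *
      ((∫ z in Set.Ioi 0, M.surplusIntegrand b i z) - ∫ z in 0..x, M.surplusIntegrand b i z))) ?_
  · have h3 := M.exp_mul_surplusIntegrand b i x 0
    simp only [mul_zero, add_zero, Real.exp_zero, one_mul] at h3
    rw [M.realValue_eq hb i hx.le]
    linear_combination (-M.c⁻¹) * h3
  · filter_upwards [lt_mem_nhds hx] with u hu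
    exact M.realValue_eq hb i hu.le

lemma hasDerivAt_realValue_of_barrier_lt (M : RiskModel n) {b : Fin n → ℝ} (hb : ∀ i, 0 ≤ b i)
    {i : Fin n} {x : ℝ} (hx : b i < x) : HasDerivAt (M.realValue b i) 1 x := by
  refine (((hasDerivAt_id x).sub_const (b i)).const_add
    (M.realValue b i (b i))).congr_of_eventuallyEq ?_
  filter_upwards [lt_mem_nhds hx] with u hu
  exact M.realValue_of_barrier_le hb i hu.le

/-- Smooth fit without optimality: the differential equation gives a two-sided derivative at the
barrier, and the linear part above the barrier identifies it as 1. -/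
lemma hasDerivAt_realValue_barrier (M : RiskModel n) {b : Fin n → ℝ} (hb : ∀ i, 0 ≤ b i)
    {i : Fin n} (hi : 0 < b i) : HasDerivAt (M.realValue b i) 1 (b i) := by
  have h := M.hasDerivAt_realValue hb hi hi
  refine h.congr_deriv ?_
  have h1 : HasDerivWithinAt (M.realValue b i) 1 (Set.Ici (b i)) (b i) := by
    refine ((((hasDerivAt_id (b i)).sub_const (b i)).const_add
      (M.realValue b i (b i))).hasDerivWithinAt).congr
      (fun u hu => M.realValue_of_barrier_le hb i hu) (M.realValue_of_barrier_le hb i le_rfl)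
  exact (uniqueDiffOn_Ici (b i) _ Set.self_mem_Ici).eq_deriv _ h.hasDerivWithinAt h1

end RiskModel

/-! ### Sign conditions from a derivative -/

lemma HasDerivAt.eventually_lt_nhdsGT {f : ℝ → ℝ} {f' x : ℝ} (hf : HasDerivAt f f' x)
    (h : 0 < f') : ∀ᶠ y in nhdsWithin x (Set.Ioi x), f x < f y := by
  have h1 := ((hasDerivAt_iff_tendsto_slope.1 hf).mono_left
    (nhdsWithin_mono x fun y (hy : x < y) => hy.ne')).eventually (lt_mem_nhds h)
  filter_upwards [h1, self_mem_nhdsWithin] with y hy hxy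
  rw [slope_def_field] at hy
  have := (div_pos_iff_of_pos_right (sub_pos.2 hxy)).1 hy
  linarith

lemma HasDerivAt.eventually_lt_nhdsLT {f : ℝ → ℝ} {f' x : ℝ} (hf : HasDerivAt f f' x)
    (h : f' < 0) : ∀ᶠ y in nhdsWithin x (Set.Iio x), f x < f y := by
  have h1 := ((hasDerivAt_iff_tendsto_slope.1 hf).mono_left
    (nhdsWithin_mono x fun y (hy : y < x) => hy.ne)).eventually (gt_mem_nhds h)
  filter_upwards [h1, self_mem_nhdsWithin] with y hy hxy
  rw [slope_def_field] at hy
  have := (div_neg_iff).1 hy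
  rcases this with h2 | h2
  · linarith
  · linarith [h2.2, Set.mem_Iio.1 hxy]

/-! ### A linear system on an interval -/

section LinearSystem

variable {w g : ℝ → ℝ} {p q a k c δ β θ : ℝ}

/-- Continuation step: if max(w, 0) < g strictly to the right of `s`, then the same bound holds at
`s`. With `s = q` the assumption is void, which starts the argument. -/
lemma linearSystem_backward_aux (hc : 0 < c) (hδ : 0 < δ) (hβ : 0 < β) (hθ0 : 0 ≤ θ) (hθ1 : θ ≤ 1)
    (ha : 0 < a) (hak : a ≤ k)
    (hw : ∀ x ∈ Set.Icc p q, HasDerivAt w ((k * w x - a * g x + δ) / c) x)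
    (hg : ∀ x ∈ Set.Icc p q, HasDerivAt g (β * (θ * w x - g x)) x)
    (hwq : w q = 0) (hgq : δ ≤ a * g q) {s : ℝ} (hs : s ∈ Set.Icc p q)
    (h : ∀ x ∈ Set.Ioc s q, max (w x) 0 < g x) :
    StrictAntiOn g (Set.Icc s q) ∧ 0 ≤ w s ∧ w s < g s := by
  have hsub : Set.Icc s q ⊆ Set.Icc p q := Set.Icc_subset_Icc_left hs.1
  have hint : interior (Set.Icc s q) = Set.Ioo s q := interior_Icc
  have hgc : ContinuousOn g (Set.Icc s q) := fun x hx =>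
    (hg x (hsub hx)).continuousAt.continuousWithinAt
  have hwc : ContinuousOn w (Set.Icc s q) := fun x hx =>
    (hw x (hsub hx)).continuousAt.continuousWithinAt
  have hanti : StrictAntiOn g (Set.Icc s q) := by
    refine strictAntiOn_of_deriv_neg (convex_Icc s q) hgc fun x hx => ?_
    rw [hint] at hx
    rw [(hg x (hsub ⟨hx.1.le, hx.2.le⟩)).deriv]
    have h1 := h x ⟨hx.1, hx.2.le⟩
    have h2 : θ * w x ≤ max (w x) 0 := by
      rcases le_total (w x) 0 with h0 | h0
      · exact (mul_nonpos_of_nonneg_of_nonpos hθ0 h0).trans (le_max_right _ _)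
      · exact (mul_le_of_le_one_left h0 hθ1).trans (le_max_left _ _)
    exact mul_neg_of_pos_of_neg hβ (by linarith)
  have hge : ∀ x ∈ Set.Icc s q, δ ≤ a * g x := fun x hx => by
    have := hanti.antitoneOn hx (Set.right_mem_Icc.2 hs.2) hx.2
    nlinarith
  have hexp : ∀ r x : ℝ, HasDerivAt (fun x => Real.exp (-r * x)) (Real.exp (-r * x) * -r) x :=
    fun r x => by
      have h1 : HasDerivAt (fun x : ℝ => -r * x) (-r) x := by
        simpa using (hasDerivAt_id x).const_mul (-r)
      exact h1.exp
  have hcexp : ∀ r : ℝ, Continuous fun x : ℝ => Real.exp (-r * x) := fun r => by fun_prop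
  have hw0 : ∀ x ∈ Set.Icc s q, 0 ≤ w x := by
    -- The integrating factor removes k w; what remains has the sign of δ - a g ≤ 0, so w ≥ 0 is
    -- inherited from w(q) = 0.
    have hmono : AntitoneOn (fun x => Real.exp (-(k / c) * x) * w x) (Set.Icc s q) := by
      refine antitoneOn_of_hasDerivWithinAt_nonpos (convex_Icc s q)
        (f' := fun x => -(Real.exp (-(k / c) * x) * ((a * g x - δ) / c)))
        ((hcexp _).continuousOn.mul hwc) (fun x hx => ?_) (fun x hx => ?_)
      · rw [hint] at hx
        refine (((hexp (k / c) x).mul (hw x (hsub ⟨hx.1.le, hx.2.le⟩))).congr_deriv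
          ?_).hasDerivWithinAt
        field_simp
        ring
      · rw [hint] at hx
        have := hge x ⟨hx.1.le, hx.2.le⟩
        exact neg_nonpos.2 (mul_nonneg (Real.exp_nonneg _) (div_nonneg (by linarith) hc.le))
    intro x hx
    have h1 := hmono hx (Set.right_mem_Icc.2 hs.2) hx.2
    simp only [hwq, mul_zero] at h1
    exact nonneg_of_mul_nonneg_right h1 (Real.exp_pos _)
  refine ⟨hanti, hw0 s (Set.left_mem_Icc.2 hs.2), ?_⟩
  -- The rate a/c cancels the g in c w' and leaves -((k - a)w + δ)/c, which is nonpositive because a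
  -- ≤ k and w ≥ 0.
  have hmono : AntitoneOn (fun x => Real.exp (-(a / c) * x) * (g x - w x)) (Set.Icc s q) := by
    refine antitoneOn_of_hasDerivWithinAt_nonpos (convex_Icc s q)
      (f' := fun x => Real.exp (-(a / c) * x) * (β * (θ * w x - g x) - ((k - a) * w x + δ) / c))
      ((hcexp _).continuousOn.mul (hgc.sub hwc)) (fun x hx => ?_) (fun x hx => ?_)
    · rw [hint] at hx
      have hx' := hsub ⟨hx.1.le, hx.2.le⟩
      refine (((hexp (a / c) x).mul ((hg x hx').sub (hw x hx'))).congr_deriv ?_).hasDerivWithinAt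
      simp only [Pi.sub_apply]
      field_simp
      ring
    · rw [hint] at hx
      have h0 := hw0 x ⟨hx.1.le, hx.2.le⟩
      have h1 := (le_max_left _ _).trans_lt (h x ⟨hx.1, hx.2.le⟩)
      have h2 : θ * w x ≤ w x := mul_le_of_le_one_left h0 hθ1
      have h3 : β * (θ * w x - g x) ≤ 0 :=
        mul_nonpos_of_nonneg_of_nonpos hβ.le (by linarith)
      have h4 : 0 ≤ ((k - a) * w x + δ) / c :=
        div_nonneg (add_nonneg (mul_nonneg (by linarith) h0) hδ.le) hc.le
      exact mul_nonpos_of_nonneg_of_nonpos (Real.exp_nonneg _) (by linarith)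
  have h1 := hmono (Set.left_mem_Icc.2 hs.2) (Set.right_mem_Icc.2 hs.2) hs.2
  have hgq0 : 0 < g q := pos_of_mul_pos_right (hδ.trans_le hgq) ha.le
  simp only [hwq, sub_zero] at h1
  have h2 := (mul_pos (Real.exp_pos (-(a / c) * q)) hgq0).trans_le h1
  linarith [pos_of_mul_pos_right h2 (Real.exp_nonneg _)]

/-- Solutions of a linear system that are suitably signed at the right end of an interval keep
their signs on the whole interval. -/
lemma linearSystem_backward (hc : 0 < c) (hδ : 0 < δ) (hβ : 0 < β) (hθ0 : 0 ≤ θ) (hθ1 : θ ≤ 1)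
    (ha : 0 < a) (hak : a ≤ k) (hpq : p < q)
    (hw : ∀ x ∈ Set.Icc p q, HasDerivAt w ((k * w x - a * g x + δ) / c) x)
    (hg : ∀ x ∈ Set.Icc p q, HasDerivAt g (β * (θ * w x - g x)) x)
    (hwq : w q = 0) (hgq : δ ≤ a * g q) : 0 ≤ w p ∧ g q < g p := by
  have aux := fun {s : ℝ} => linearSystem_backward_aux (s := s) hc hδ hβ hθ0 hθ1 ha hak hw hg hwq hgq
  have hgq0 : 0 < g q := pos_of_mul_pos_right (hδ.trans_le hgq) ha.le
  have hgc : ContinuousOn g (Set.Icc p q) := fun x hx =>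
    (hg x hx).continuousAt.continuousWithinAt
  have hwc : ContinuousOn w (Set.Icc p q) := fun x hx =>
    (hw x hx).continuousAt.continuousWithinAt
  -- The largest point violating the bound would satisfy it, by the continuation step.
  have hgood : ∀ x ∈ Set.Icc p q, max (w x) 0 < g x := by
    by_contra! hbad
    set K := {x ∈ Set.Icc p q | g x ≤ max (w x) 0} with hK
    have hKc : IsCompact K := by
      refine isCompact_Icc.of_isClosed_subset ?_ fun x hx => hx.1
      exact isClosed_Icc.isClosed_le hgc (hwc.sup continuousOn_const)
    obtain ⟨x, hx, hx'⟩ := hbad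
    obtain ⟨s, hs, hmax⟩ := hKc.exists_isGreatest ⟨x, hx, hx'⟩
    have hs1 := hs.1
    obtain ⟨hanti, hws, hlt⟩ := aux hs1 fun y hy => by
      by_contra! hy'
      exact absurd (hmax ⟨⟨hs1.1.trans hy.1.le, hy.2⟩, hy'⟩) (not_le.2 hy.1)
    have h1 := hs.2
    rw [max_eq_left hws] at h1
    linarith
  obtain ⟨hanti, hwp, -⟩ := aux (Set.left_mem_Icc.2 hpq.le) fun x hx => hgood x ⟨hx.1.le, hx.2⟩
  exact ⟨hwp, hanti (Set.left_mem_Icc.2 hpq.le) (Set.right_mem_Icc.2 hpq.le) hpq⟩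

end LinearSystem

namespace RiskModel

variable {n : ℕ}

/-! ### First-order conditions for optimal barriers -/

/-- Otherwise a slightly higher barrier gains at every surplus above `b i` and changes nothing
below. -/
lemma deriv_gain_nonpos_of_isOptimal (M : RiskModel n) {b : Fin n → ℝ} (hb : M.IsOptimal b)
    {i : Fin n} (hi : 0 < b i) {D : ℝ} (hD : HasDerivAt (M.gain b i) D (b i)) : D ≤ 0 := by
  by_contra! h
  obtain ⟨u, hu, hsub⟩ := mem_nhdsGT_iff_exists_Ioo_subset.1 (hD.eventually_lt_nhdsGT h)
  have hu' : b i < u := hu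
  have hlt : ∀ y, b i < y → y ≤ (b i + u) / 2 → M.gain b i (b i) < M.gain b i y := fun y h1 h2 =>
    hsub ⟨h1, by linarith⟩
  refine M.not_gain_lt_of_isOptimal hb hi (B := (b i + u) / 2) (by linarith) (fun z _ => ?_)
    (hlt _ (by linarith) le_rfl)
  rcases le_or_gt z (b i) with hz | hz
  · rw [min_eq_left hz, min_eq_left (by linarith)]
  · rw [min_eq_right hz.le]
    exact (hlt _ (lt_min hz (by linarith)) (min_le_right _ _)).le

lemma deriv_gain_nonneg_of_isOptimal (M : RiskModel n) {b : Fin n → ℝ} (hb : M.IsOptimal b)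
    {i : Fin n} (hi : 0 < b i) {D : ℝ} (hD : HasDerivAt (M.gain b i) D (b i)) : 0 ≤ D := by
  by_contra! h
  obtain ⟨y, hy, hy0, hyi⟩ := ((hD.eventually_lt_nhdsLT h).and (Ioo_mem_nhdsLT hi)).exists
  have hcont : ContinuousOn (M.gain b i) (Set.Icc y (b i)) := fun z hz =>
    (M.continuousAt_gain hb.1 i (hy0.trans_le hz.1)).continuousWithinAt
  -- The point `y` itself may fail as a barrier, since `gain` could be larger between `y` and `b i`;
  -- a maximizer dominates every surplus cut off by lowering the barrier.
  obtain ⟨B, hB, hmax⟩ := isCompact_Icc.exists_isMaxOn (Set.nonempty_Icc.2 hyi.le) hcont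
  refine M.not_gain_lt_of_isOptimal hb hi (B := B) (hy0.le.trans hB.1) (fun z _ => ?_)
    (hy.trans_le (hmax (Set.left_mem_Icc.2 hyi.le)))
  rcases le_or_gt z B with hz | hz
  · rw [min_eq_left hz, min_eq_left (hz.trans hB.2)]
  · rw [min_eq_right hz.le]
    exact hmax ⟨hB.1.trans (le_min hz.le hB.2), min_le_right _ _⟩

/-! ### Two phases -/

lemma gain_zero_eq (M : RiskModel 2) {b : Fin 2 → ℝ} (hb : ∀ i, 0 ≤ b i) (y : ℝ) :
    M.gain b 0 y = M.Λ 0 1 * M.realValue b 1 y + M.Λ 0 2 * M.realClaimValue b y -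
      M.killRate 0 * y := by
  rw [M.gain_eq hb, show (Finset.univ.erase (0 : Fin 2)) = {1} from rfl, Finset.sum_singleton]
  rfl

lemma gain_one_eq (M : RiskModel 2) {b : Fin 2 → ℝ} (hb : ∀ i, 0 ≤ b i) (y : ℝ) :
    M.gain b 1 y = M.Λ 1 0 * M.realValue b 0 y + M.Λ 1 2 * M.realClaimValue b y -
      M.killRate 1 * y := by
  rw [M.gain_eq hb, show (Finset.univ.erase (1 : Fin 2)) = {0} from rfl, Finset.sum_singleton]
  rfl

lemma killRate_zero_eq (M : RiskModel 2) : M.killRate 0 = M.Λ 0 1 + M.Λ 0 2 + M.δ := by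
  have h := M.Λ_row 0
  rw [Fin.sum_univ_three] at h
  have : M.killRate 0 = -M.Λ 0 0 + M.δ := rfl
  linarith

lemma killRate_one_eq (M : RiskModel 2) : M.killRate 1 = M.Λ 1 0 + M.Λ 1 2 + M.δ := by
  have h := M.Λ_row 1
  rw [Fin.sum_univ_three] at h
  have : M.killRate 1 = -M.Λ 1 1 + M.δ := rfl
  linarith

end RiskModel

end

theorem mainTheorem4 (M : RiskModel 2) (b : Fin 2 → ℝ) (hb : M.IsOptimal b)
    (h₁ : 0 < b 0) (h₂ : b 0 < b 1) : M.Λ 0 2 < M.Λ 1 2 := by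
  have hb0 := hb.1
  have h₃ : 0 < b 1 := h₁.trans h₂
  have hc := M.c_pos
  have hδ := M.δ_pos
  have hβ := M.β_pos
  have hΛ01 : 0 ≤ M.Λ 0 1 := M.Λ_nonneg 0 1 (by decide)
  have hΛ02 : 0 ≤ M.Λ 0 2 := M.Λ_nonneg 0 2 (by decide)
  have hΛ10 : 0 ≤ M.Λ 1 0 := M.Λ_nonneg 1 0 (by decide)
  have hΛ12 : 0 ≤ M.Λ 1 2 := M.Λ_nonneg 1 2 (by decide)
  have hπ : M.π 0 + M.π 1 = 1 := by
    have := M.π_sum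
    rwa [Fin.sum_univ_two] at this
  -- On [b 0, b 1] these are the derivatives of the value in phase `1` and of the value after a
  -- claim, minus 1. The formula for `w`, which need not have this meaning above `b 1`, is
  -- differentiable from both sides at `b 1`.
  set w : ℝ → ℝ := fun x => (M.killRate 1 * (M.realValue b 1 x - x) - M.gain b 1 x) / M.c - 1
    with hw_def
  set g : ℝ → ℝ := fun x => M.β * (M.restartValue b x - M.realClaimValue b x) - 1 with hg_def
  have hv0 : ∀ x ∈ Set.Icc (b 0) (b 1), HasDerivAt (M.realValue b 0) 1 x := fun x hx => by
    rcases hx.1.eq_or_lt with h | h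
    · exact h ▸ M.hasDerivAt_realValue_barrier hb0 h₁
    · exact M.hasDerivAt_realValue_of_barrier_lt hb0 h
  have hv1 : ∀ x ∈ Set.Icc (b 0) (b 1), HasDerivAt (M.realValue b 1) (w x + 1) x := fun x hx => by
    have h := M.hasDerivAt_realValue hb0 h₃ (h₁.trans_le hx.1)
    rw [min_eq_left hx.2] at h
    exact h.congr_deriv (by simp [hw_def])
  have hG : ∀ x ∈ Set.Icc (b 0) (b 1), HasDerivAt (M.realClaimValue b) (g x + 1) x := fun x hx =>
    (M.hasDerivAt_realClaimValue hb0 (h₁.trans_le hx.1)).congr_deriv (by simp [hg_def])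
  have hgain0 : ∀ x ∈ Set.Icc (b 0) (b 1), HasDerivAt (M.gain b 0)
      (M.Λ 0 1 * w x + M.Λ 0 2 * g x - M.δ) x := fun x hx => by
    rw [funext (M.gain_zero_eq hb0)]
    refine ((((hv1 x hx).const_mul _).add ((hG x hx).const_mul _)).sub
      ((hasDerivAt_id x).const_mul _)).congr_deriv ?_
    rw [M.killRate_zero_eq]
    ring
  have hgain1 : ∀ x ∈ Set.Icc (b 0) (b 1), HasDerivAt (M.gain b 1) (M.Λ 1 2 * g x - M.δ) x :=
    fun x hx => by
    rw [funext (M.gain_one_eq hb0)]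
    refine ((((hv0 x hx).const_mul _).add ((hG x hx).const_mul _)).sub
      ((hasDerivAt_id x).const_mul _)).congr_deriv ?_
    rw [M.killRate_one_eq]
    ring
  have hw : ∀ x ∈ Set.Icc (b 0) (b 1),
      HasDerivAt w ((M.killRate 1 * w x - M.Λ 1 2 * g x + M.δ) / M.c) x := fun x hx => by
    refine ((((((hv1 x hx).sub (hasDerivAt_id x)).const_mul _).sub (hgain1 x hx)).div_const
      _).sub_const _).congr_deriv ?_
    ring
  have hg : ∀ x ∈ Set.Icc (b 0) (b 1), HasDerivAt g (M.β * (M.π 1 * w x - g x)) x := fun x hx => by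
    have hH : HasDerivAt (M.restartValue b) (M.π 0 * 1 + M.π 1 * (w x + 1)) x := by
      have e : M.restartValue b = fun y => M.π 0 * M.realValue b 0 y + M.π 1 * M.realValue b 1 y :=
        funext fun y => Fin.sum_univ_two _
      rw [e]
      exact ((hv0 x hx).const_mul _).add ((hv1 x hx).const_mul _)
    refine (((hH.sub (hG x hx)).const_mul _).sub_const _).congr_deriv ?_
    linear_combination M.β * hπ
  have hq : b 1 ∈ Set.Icc (b 0) (b 1) := Set.right_mem_Icc.2 h₂.le
  have hp : b 0 ∈ Set.Icc (b 0) (b 1) := Set.left_mem_Icc.2 h₂.le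
  -- Smooth fit at the upper barrier.
  have hwq : w (b 1) = 0 := by
    have := (hv1 _ hq).unique (M.hasDerivAt_realValue_barrier hb0 h₃)
    linarith
  have hgq : M.δ ≤ M.Λ 1 2 * g (b 1) := by
    have := M.deriv_gain_nonneg_of_isOptimal hb h₃ (hgain1 _ hq)
    linarith
  have hgp : M.Λ 0 1 * w (b 0) + M.Λ 0 2 * g (b 0) ≤ M.δ := by
    have := M.deriv_gain_nonpos_of_isOptimal hb h₁ (hgain0 _ hp)
    linarith
  have ha : 0 < M.Λ 1 2 := lt_of_le_of_ne hΛ12 fun h => by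
    rw [← h, zero_mul] at hgq
    linarith
  obtain ⟨hwp, hlt⟩ := linearSystem_backward hc hδ hβ (M.π_nonneg 1)
    (by linarith [M.π_nonneg 0]) ha (by rw [M.killRate_one_eq]; linarith) h₂ hw hg hwq hgq
  by_contra! hcon
  have hgq0 : 0 < g (b 1) := pos_of_mul_pos_right (hδ.trans_le hgq) ha.le
  have h4 : M.Λ 1 2 * g (b 1) < M.Λ 0 2 * g (b 0) :=
    (mul_lt_mul_of_pos_left hlt ha).trans_le
      (mul_le_mul_of_nonneg_right hcon (hgq0.trans hlt).le)
  linarith [mul_nonneg hΛ01 hwp]
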